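/- **Notation.** $\|\cdot\|$ is the Euclidean norm (spectral norm for matrices), $\|x\|_P=\sqrt{x^\top Px}$, and $\overline\lambda_M,\underline\lambda_M$ are the largest and smallest eigenvalue of a symmetric matrix $M$. For a sequence $z$, $z_{[a,b]}$ is the stacked vector $(z_a,\dots,z_b)$, and $H_L(z)$ is the Hankel matrix with $L$ block rows of $z_0,\dots,z_{N-1}$. The sequence $z$ with values in $\mathbb R^m$ is persistently exciting of order $L$ if $\operatorname{rank}H_L(z)=mL$. A function $\alpha:[0,\infty)\to[0,\infty)$ is of class $\mathcal K_\infty$ if it is continuous, strictly increasing, unbounded and $\alpha(0)=0$. **System.** Let $x_{t+1}=Ax_t+Bu_t$, $y_t=Cx_t+Du_t$ with $x_t\in\mathbb R^{n_x}$, $u_t\in\mathbb R^{n_u}$, $y_t\in\mathbb R^{n_y}$, $(A,B)$ controllable and $(C,A)$ observable. Let $\eta\in\{1,\dots,n_x\}$ be the observability index, i.e. the smallest integer such that $\Theta=[C^\top\ (CA)^\top\cdots(CA^{\eta-1})^\top]^\top$ has rank $n_x$, and put $\Theta^\dagger=(\Theta^\top\Theta)^{-1}\Theta^\top$. The extended state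 is $\xi_t=(u_{[t-\eta,t-1]},y_{[t-\eta,t-1]})\in\mathbb R^{n_\xi}$. Let $(\tilde A,\tilde B,\tilde C,\tilde D)$ be any matrices with $\xi_{t+1}=\tilde A\xi_t+\tilde Bu_t$ and $y_t=\tilde C\xi_t+\tilde Du_t$ along all trajectories of the system. The controller receives $\zeta_t=y_t+n_t$ with $\|n_t\|\le\bar n$. **Data.** $L\ge\eta+1$; $u^p_0,\dots,u^p_{N-1}$ is persistently exciting of order $L+n_x+\eta$, and $y^p$ is the output of the system for this input from some initial state. $H_{u\xi}$ is $H_{L+\eta}(u^p)$ stacked on $[\xi^p_\eta\ \cdots\ \xi^p_{N-L}]$, where $\xi^p$ is the extended state of the data, and $H_{u\xi}^\ddagger$ is its Moore–Penrose inverse. **Terminal ingredients.** Let $R,Q\succ0$ and let $\mathbb U\subseteq\mathbb R^{n_u}$ be convex; the equilibrium is the origin. Call $(P,K,\epsilon)$ *terminal ingredients* if $P=P^\top\succ0$, $\Xi_\epsilon=\{\xi:\|\xi\|_P\le\epsilon\}\subseteq\mathbb U^\eta\times(\mathbb R^{n_y})^\eta$, and for all $\xi\in\Xi_\epsilon$: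 $K\xi\in\mathbb U$, $\tilde A\xi+\tilde BK\xi\in\Xi_\epsilon$ and $\|(\tilde A+\tilde BK)\xi\|_P^2\le\|\xi\|_P^2-\|K\xi\|_R^2-\|(\tilde C+\tilde DK)\xi\|_Q^2$. **MPC problem at time $t$.** Minimize over $g$ and $\bar u_i,\bar y_i,h_i$ ($-\eta\le i\le L-1$) the cost $$\sum_{i=0}^{L-1}\big(\|\bar u_i\|_R^2+\|\bar y_i\|_Q^2\big)+\frac{\lambda_h}{\bar n}\|h\|^2+\lambda_g\bar n\|g\|^2+\|\bar\xi_L\|_P^2,\qquad \bar\xi_i=(\bar u_{[i-\eta,i-1]},\bar y_{[i-\eta,i-1]}),$$ subject to $\bar u=H_{L+\eta}(u^p)g$, $\bar y+h=H_{L+\eta}(y^p)g$, $\bar u_{[-\eta,-1]}=u_{[t-\eta,t-1]}$, $\bar y_{[-\eta,-1]}=\zeta_{[t-\eta,t-1]}$, $\bar\xi_L\in\Xi_\epsilon$, and $\bar u_i\in\mathbb U$ for $1\le i\le L-1$. A star denotes any optimal solution. **Theorem.** There is $\bar\sigma\in(0,1)$, depending only on $A,B,C,D,R,Q$, such that the following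 holds. Take $\tilde A,\tilde B,\tilde C,\tilde D$, $N,L$, the data and $\mathbb U$ as above, $\lambda_g,\lambda_h,\epsilon,r>0$, $0<\sigma<\bar\sigma$, terminal ingredients $(P,K,\epsilon)$ and $(P_r,K_r,r)$ (for the same $R,Q,\mathbb U$) with $$\frac{\overline\lambda_P}{\underline\lambda_{P_r}}\Big(1-\frac{\underline\lambda_{K_r^\top RK_r}}{\overline\lambda_{P_r}}\Big)^Lr^2\le\epsilon^2\le r^2,$$ and numbers $\rho^i\ge\|CA^i\Theta^\dagger\|$, $i\ge 0$. Then there are $c>0$, $\gamma_2\in(0,1)$ and $\alpha\in\mathcal K_\infty$, independent of $\bar n$, of the initial condition and of the noise, such that for every $\bar n>0$ the closed loop is practically exponentially stable along the triggering times: $$\|\xi_{t_\ell}\|^2\le c\,\gamma_2^\ell\,\|\xi_{t_0}\|^2+\alpha(\bar n).$$ Here $t_0=0$, $t_{k+1}=t_k+\tau_k$, the system equations and the noise bound hold from time $-\eta$ on, the MPC problem is solved at each $t_k$, $u_{t_k+i}=\bar u^*_i(t_k)$ for $0\le i<\tau_k$, and each $\tau_k\in\{1,\dots,L-1\}$ satisfies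 (with $\tau=\tau_k$ and the optimal solution at $t_k$) $$\big(\sqrt\eta\,\bar n+\|h^*_{[-\eta,-1]}\|\big)\sqrt{\textstyle\sum_{i=\tau}^{\tau+\eta-1}(\rho^i)^2}+\|h^*_{[\tau-\eta,\tau-1]}\|\le\frac{r}{\sqrt{\overline\lambda_{P_r}}}-\|\bar\xi^*_\tau\|$$ and, with $\mu=\lambda_g\bar n\|H_{u\xi}^\ddagger\|^2(1+\overline\lambda_{P_r}/\underline\lambda_R)$, $$2\big[\overline\lambda_Q+2\overline\lambda_{P_r}+\mu\big]\Big[\big(\eta\bar n^2+\|h^*_{[-\eta,-1]}\|^2\big)\sum_{i=0}^{\tau-1}(\rho^{i+\eta})^2+\sum_{i=0}^{\tau-1}\|h_i^*\|^2\Big]+\lambda_h\eta\bar n^2+\epsilon^2+2\big[\overline\lambda_{P_r}+\mu\big]\|\bar\xi^*_\tau\|^2\le\sigma\sum_{i=0}^{\tau-1}\|\bar\xi^*_i\|^2 .$$ The bound holds for all $\ell$ in an infinite closed loop; more generally, it holds at $t_0,\dots,t_M$ whenever these rules are obeyed at $t_0,\dots,t_{M-1}$. -/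

import Mathlib

/-! ### Norms, eigenvalues, pseudo-inverses -/

/-- Euclidean norm of a coordinate vector indexed by a finite type. -/
noncomputable def l2norm {ι : Type*} [Fintype ι] (x : ι → ℝ) : ℝ :=
  ‖(WithLp.toLp 2 x : EuclideanSpace ℝ ι)‖

/-- The squared weighted norm `xᵀ P x`. -/
def wsq {ι : Type*} [Fintype ι] (P : Matrix ι ι ℝ) (x : ι → ℝ) : ℝ :=
  x ⬝ᵥ P.mulVec x

/-- The weighted norm `√(xᵀ P x)`. -/
noncomputable def wnorm {ι : Type*} [Fintype ι] (P : Matrix ι ι ℝ) (x : ι → ℝ) : ℝ :=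
  Real.sqrt (wsq P x)

open scoped Matrix.Norms.L2Operator in
/-- Spectral norm (operator norm for the Euclidean norms) of a rectangular real matrix. -/
noncomputable def specNorm {m n : Type*} [Fintype m] [DecidableEq m] [Fintype n] [DecidableEq n]
    (M : Matrix m n ℝ) : ℝ := ‖M‖

/-- Largest eigenvalue of a symmetric real matrix. -/
noncomputable def lamMax {ι : Type*} [Fintype ι] [DecidableEq ι] (M : Matrix ι ι ℝ) : ℝ :=
  sSup (spectrum ℝ M)

/-- Smallest eigenvalue of a symmetric real matrix. -/
noncomputable def lamMin {ι : Type*} [Fintype ι] [DecidableEq ι] (M : Matrix ι ι ℝ) : ℝ :=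
  sInf (spectrum ℝ M)

/-- Left pseudo-inverse `(Mᵀ M)⁻¹ Mᵀ` of a matrix with full column rank. -/
noncomputable def leftPinv {m n : Type*} [Fintype m] [Fintype n] [DecidableEq n]
    (M : Matrix m n ℝ) : Matrix n m ℝ := (M.transpose * M)⁻¹ * M.transpose

/-- The four Penrose equations: `X` is the Moore–Penrose inverse of `M`. -/
structure IsMoorePenrose {m n : Type*} [Fintype m] [Fintype n]
    (M : Matrix m n ℝ) (X : Matrix n m ℝ) : Prop where
  mxm : M * X * M = M
  xmx : X * M * X = X
  symm_mx : (M * X).transpose = M * X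
  symm_xm : (X * M).transpose = X * M

theorem exists_isMoorePenrose {m n : Type*} [Fintype m] [Fintype n]
    [DecidableEq n] (M : Matrix m n ℝ) : ∃ X : Matrix n m ℝ, IsMoorePenrose M X := by
  set S : Matrix n n ℝ := M.transpose * M with hS
  have hH : S.IsHermitian := by
    have := Matrix.isHermitian_conjTranspose_mul_self M
    simpa [hS, Matrix.conjTranspose_eq_transpose_of_trivial] using this
  let U : Matrix n n ℝ := (hH.eigenvectorUnitary : Matrix n n ℝ)
  have hUU : U.transpose * U = 1 := by
    have := Unitary.coe_star_mul_self hH.eigenvectorUnitary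
    simpa [U, Matrix.star_eq_conjTranspose,
      Matrix.conjTranspose_eq_transpose_of_trivial] using this
  let E : Matrix n n ℝ := Matrix.diagonal hH.eigenvalues
  let F : Matrix n n ℝ := Matrix.diagonal (fun i => (hH.eigenvalues i)⁻¹)
  have hSE : S = U * E * U.transpose := by
    have := hH.spectral_theorem
    rw [Unitary.conjStarAlgAut_apply] at this
    simpa [U, E, Matrix.star_eq_conjTranspose, Function.comp_def,
      Matrix.conjTranspose_eq_transpose_of_trivial] using this
  have hEFE : E * F * E = E := by
    simp only [E, F, Matrix.diagonal_mul_diagonal]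
    congr 1
    funext i
    exact mul_inv_mul_cancel _
  have hFEF : F * E * F = F := by
    simp only [E, F, Matrix.diagonal_mul_diagonal]
    congr 1
    funext i
    by_cases h : hH.eigenvalues i = 0
    · simp [h]
    · field_simp
  have hEF : E * F = F * E := by
    simp only [E, F, Matrix.diagonal_mul_diagonal]
    congr 1
    funext i
    exact mul_comm _ _
  let G : Matrix n n ℝ := U * F * U.transpose
  have hGt : G.transpose = G := by
    simp [G, F, Matrix.transpose_mul, Matrix.mul_assoc]
  have hSt : S.transpose = S := by simp [hS, Matrix.transpose_mul]
  have key : ∀ X Y : Matrix n n ℝ, (U * X * U.transpose) * (U * Y * U.transpose)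
      = U * (X * Y) * U.transpose := by
    intro X Y
    calc (U * X * U.transpose) * (U * Y * U.transpose)
        = U * X * (U.transpose * U) * Y * U.transpose := by simp only [Matrix.mul_assoc]
      _ = U * (X * Y) * U.transpose := by rw [hUU]; simp only [Matrix.mul_assoc, Matrix.one_mul]
  have hSGS : S * G * S = S := by
    rw [hSE]
    simp only [G]
    rw [key, key, hEFE]
  have hGSG : G * S * G = G := by
    rw [hSE]
    simp only [G]
    rw [key, key, hFEF]
  have hSG : S * G = G * S := by
    rw [hSE]
    simp only [G]
    rw [key, key, hEF]
  have hMGS : M * G * S = M := by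
    have h0 : (M * G * S - M).transpose * (M * G * S - M) = 0 := by
      have e : (M * G * S - M).transpose = (S * G - 1) * M.transpose := by
        simp [Matrix.transpose_mul, hGt, hSt, Matrix.sub_mul, Matrix.mul_assoc]
      have e2 : M * G * S - M = M * (G * S - 1) := by
        simp [Matrix.mul_sub, Matrix.mul_assoc]
      calc (M * G * S - M).transpose * (M * G * S - M)
          = (S * G - 1) * M.transpose * (M * (G * S - 1)) := by rw [e, e2]
        _ = (S * G - 1) * S * (G * S - 1) := by simp only [hS, Matrix.mul_assoc]
        _ = 0 := by rw [sub_mul, hSGS]; simp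
    have h1 : (M * G * S - M).conjTranspose * (M * G * S - M) = 0 := by
      rw [Matrix.conjTranspose_eq_transpose_of_trivial]; exact h0
    exact sub_eq_zero.mp (Matrix.conjTranspose_mul_self_eq_zero.mp h1)
  refine ⟨G * M.transpose, ⟨?_, ?_, ?_, ?_⟩⟩
  · calc M * (G * M.transpose) * M = M * G * S := by simp only [hS, Matrix.mul_assoc]
      _ = M := hMGS
  · calc G * M.transpose * M * (G * M.transpose) = G * S * G * M.transpose := by
          simp only [hS, Matrix.mul_assoc]
      _ = G * M.transpose := by rw [hGSG]
  · simp [Matrix.transpose_mul, hGt, Matrix.mul_assoc]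
  · calc (G * M.transpose * M).transpose = (G * S).transpose := by
          simp only [hS, Matrix.mul_assoc]
      _ = S * G := by rw [Matrix.transpose_mul, hGt, hSt]
      _ = G * M.transpose * M := by rw [hSG]; simp only [hS, Matrix.mul_assoc]

/-- The Moore–Penrose inverse; it is the right pseudo-inverse when `M` has full row rank. -/
noncomputable def pinv {m n : Type*} [Fintype m] [Fintype n] [DecidableEq n]
    (M : Matrix m n ℝ) : Matrix n m ℝ := (exists_isMoorePenrose M).choose

theorem pinv_spec {m n : Type*} [Fintype m] [Fintype n] [DecidableEq n]
    (M : Matrix m n ℝ) : IsMoorePenrose M (pinv M) := (exists_isMoorePenrose M).choose_spec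

/-- Class `𝒦_∞` functions on `[0,∞)`. -/
structure IsKInf (α : ℝ → ℝ) : Prop where
  cont : ContinuousOn α (Set.Ici 0)
  strictMono : StrictMonoOn α (Set.Ici 0)
  zero : α 0 = 0
  unbounded : Filter.Tendsto α Filter.atTop Filter.atTop

/-! ### Discrete-time signals and linear systems -/

/-- Vector-valued discrete-time signals; only the values on the relevant time windows matter. -/
abbrev Signal (m : ℕ) := ℤ → Fin m → ℝ

/-- The stacked window `(z_a, …, z_{a+k-1})`. -/
def window {m : ℕ} (z : Signal m) (a : ℤ) (k : ℕ) : Fin k × Fin m → ℝ :=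
  fun p => z (a + (p.1 : ℕ)) p.2

/-- Index type of the extended state: `η` past inputs and `η` past outputs. -/
abbrev ExtIdx (nu ny η : ℕ) := (Fin η × Fin nu) ⊕ (Fin η × Fin ny)

/-- The extended state `ξ_t = (u_{[t-η,t-1]}, y_{[t-η,t-1]})`. -/
def extState {nu ny : ℕ} (η : ℕ) (u : Signal nu) (y : Signal ny) (t : ℤ) :
    ExtIdx nu ny η → ℝ :=
  Sum.elim (window u (t - η) η) (window y (t - η) η)

/-- `x_{t+1} = A x_t + B u_t` and `y_t = C x_t + D u_t` for all times `t ∈ T`. -/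
def IsTrajOn {nx nu ny : ℕ} (A : Matrix (Fin nx) (Fin nx) ℝ) (B : Matrix (Fin nx) (Fin nu) ℝ)
    (C : Matrix (Fin ny) (Fin nx) ℝ) (D : Matrix (Fin ny) (Fin nu) ℝ)
    (x : Signal nx) (u : Signal nu) (y : Signal ny) (T : Set ℤ) : Prop :=
  ∀ t ∈ T, x (t + 1) = A.mulVec (x t) + B.mulVec (u t) ∧
    y t = C.mulVec (x t) + D.mulVec (u t)

/-- The controllability matrix `[B, AB, …, A^{n_x-1}B]`. -/
def ctrbMatrix {nx nu : ℕ} (A : Matrix (Fin nx) (Fin nx) ℝ) (B : Matrix (Fin nx) (Fin nu) ℝ) :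
    Matrix (Fin nx) (Fin nx × Fin nu) ℝ :=
  Matrix.of fun i p => (A ^ (p.1 : ℕ) * B) i p.2

/-- The observability matrix with block rows `C, CA, …, CA^{k-1}`. -/
def obsvMatrix {nx ny : ℕ} (A : Matrix (Fin nx) (Fin nx) ℝ) (C : Matrix (Fin ny) (Fin nx) ℝ)
    (k : ℕ) : Matrix (Fin k × Fin ny) (Fin nx) ℝ :=
  Matrix.of fun p j => (C * A ^ (p.1 : ℕ)) p.2 j

def IsControllable {nx nu : ℕ} (A : Matrix (Fin nx) (Fin nx) ℝ)
    (B : Matrix (Fin nx) (Fin nu) ℝ) : Prop := (ctrbMatrix A B).rank = nx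

def IsObservable {nx ny : ℕ} (A : Matrix (Fin nx) (Fin nx) ℝ)
    (C : Matrix (Fin ny) (Fin nx) ℝ) : Prop := (obsvMatrix A C nx).rank = nx

/-- `η` is the smallest integer in `{1, …, n_x}` for which the observability matrix has rank
`n_x`. -/
def IsObservabilityIndex {nx ny : ℕ} (A : Matrix (Fin nx) (Fin nx) ℝ)
    (C : Matrix (Fin ny) (Fin nx) ℝ) (η : ℕ) : Prop :=
  IsLeast {k : ℕ | 1 ≤ k ∧ k ≤ nx ∧ (obsvMatrix A C k).rank = nx} η

/-- The matrices `(Ã, B̃, C̃, D̃)` describe the system in extended-state form: along every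
trajectory (started `η` steps earlier), `ξ_{t+1} = Ã ξ_t + B̃ u_t` and `y_t = C̃ ξ_t + D̃ u_t`. -/
def IsExtRealization {nx nu ny : ℕ} (A : Matrix (Fin nx) (Fin nx) ℝ)
    (B : Matrix (Fin nx) (Fin nu) ℝ) (C : Matrix (Fin ny) (Fin nx) ℝ)
    (D : Matrix (Fin ny) (Fin nu) ℝ) (η : ℕ)
    (At : Matrix (ExtIdx nu ny η) (ExtIdx nu ny η) ℝ) (Bt : Matrix (ExtIdx nu ny η) (Fin nu) ℝ)
    (Ct : Matrix (Fin ny) (ExtIdx nu ny η) ℝ) (Dt : Matrix (Fin ny) (Fin nu) ℝ) : Prop :=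
  ∀ (x : Signal nx) (u : Signal nu) (y : Signal ny) (t : ℤ),
    IsTrajOn A B C D x u y (Set.Ici (t - η)) →
      extState η u y (t + 1) = At.mulVec (extState η u y t) + Bt.mulVec (u t) ∧
      y t = Ct.mulVec (extState η u y t) + Dt.mulVec (u t)

/-! ### Pre-collected data -/

/-- The Hankel matrix `H_L(z)` with `L` block rows of the data `z_0, …, z_{N-1}`. -/
def hankel {m : ℕ} (N L : ℕ) (z : Signal m) : Matrix (Fin L × Fin m) (Fin (N + 1 - L)) ℝ :=
  Matrix.of fun p j => z ((p.1 : ℕ) + (j : ℕ)) p.2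

/-- `z_0, …, z_{N-1}` is persistently exciting of order `L`. -/
def IsPersistentlyExciting {m : ℕ} (N L : ℕ) (z : Signal m) : Prop :=
  (hankel N L z).rank = m * L

/-- The matrix `H_{uξ}`: the Hankel matrix `H_{L+η}(u^p)` stacked on the data extended states
`[ξ^p_η, ξ^p_{η+1}, …, ξ^p_{N-L}]`. -/
def hankelExt {nu ny : ℕ} (N L η : ℕ) (up : Signal nu) (yp : Signal ny) :
    Matrix ((Fin (L + η) × Fin nu) ⊕ ExtIdx nu ny η) (Fin (N + 1 - (L + η))) ℝ :=
  Matrix.fromRows (hankel N (L + η) up)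
    (Matrix.of fun q j => extState η up yp (((j : ℕ) : ℤ) + η) q)

/-! ### The data-driven MPC problem (equilibrium at the origin) -/

/-- Terminal ingredients: `P ≻ 0`, a gain `K` and the ellipsoid `Ξ_ε = {ξ : ‖ξ‖_P ≤ ε}`. -/
structure IsTerminal {nu ny η : ℕ}
    (At : Matrix (ExtIdx nu ny η) (ExtIdx nu ny η) ℝ) (Bt : Matrix (ExtIdx nu ny η) (Fin nu) ℝ)
    (Ct : Matrix (Fin ny) (ExtIdx nu ny η) ℝ) (Dt : Matrix (Fin ny) (Fin nu) ℝ)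
    (R : Matrix (Fin nu) (Fin nu) ℝ) (Q : Matrix (Fin ny) (Fin ny) ℝ) (U : Set (Fin nu → ℝ))
    (P : Matrix (ExtIdx nu ny η) (ExtIdx nu ny η) ℝ) (K : Matrix (Fin nu) (ExtIdx nu ny η) ℝ)
    (ε : ℝ) : Prop where
  posDef : P.PosDef
  /-- `Ξ_ε ⊆ U^η × (ℝ^{n_y})^η` -/
  subset : ∀ ξ, wnorm P ξ ≤ ε → ∀ k : Fin η, (fun i => ξ (Sum.inl (k, i))) ∈ U
  input_mem : ∀ ξ, wnorm P ξ ≤ ε → K.mulVec ξ ∈ U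
  invariant : ∀ ξ, wnorm P ξ ≤ ε → wnorm P (At.mulVec ξ + Bt.mulVec (K.mulVec ξ)) ≤ ε
  decrease : ∀ ξ, wnorm P ξ ≤ ε →
    wsq P ((At + Bt * K).mulVec ξ) ≤
      wsq P ξ - wsq R (K.mulVec ξ) - wsq Q ((Ct + Dt * K).mulVec ξ)

/-- Decision variables of the MPC problem: predicted input and output and the slack, as signals
of which only the times `-η, …, L-1` (relative to the triggering time) matter, and the
coefficient vector `g`. -/
structure MPCVar (nu ny m : ℕ) where
  ubar : Signal nu
  ybar : Signal ny
  h : Signal ny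
  g : Fin m → ℝ

/-- The predicted extended state `ξ̄_i`. -/
def MPCVar.xibar {nu ny m : ℕ} (v : MPCVar nu ny m) (η : ℕ) (i : ℤ) : ExtIdx nu ny η → ℝ :=
  extState η v.ubar v.ybar i

/-- The MPC objective. -/
noncomputable def mpcCost {nu ny m : ℕ} (η L : ℕ) (R : Matrix (Fin nu) (Fin nu) ℝ)
    (Q : Matrix (Fin ny) (Fin ny) ℝ) (P : Matrix (ExtIdx nu ny η) (ExtIdx nu ny η) ℝ)
    (lamg lamh nbar : ℝ) (v : MPCVar nu ny m) : ℝ :=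
  (∑ i ∈ Finset.range L, (wsq R (v.ubar (i : ℤ)) + wsq Q (v.ybar (i : ℤ))))
    + lamh / nbar * l2norm (window v.h (-(η : ℤ)) (L + η)) ^ 2
    + lamg * nbar * l2norm v.g ^ 2
    + wsq P (v.xibar η (L : ℤ))

/-- The MPC constraints at time `t`, for past inputs `u` and received noisy outputs `ζ`. -/
structure MPCFeasible {nu ny : ℕ} (N L η : ℕ) (up : Signal nu) (yp : Signal ny)
    (U : Set (Fin nu → ℝ)) (P : Matrix (ExtIdx nu ny η) (ExtIdx nu ny η) ℝ) (ε : ℝ)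
    (u : Signal nu) (ζ : Signal ny) (t : ℤ) (v : MPCVar nu ny (N + 1 - (L + η))) : Prop where
  hankel_u : window v.ubar (-(η : ℤ)) (L + η) = (hankel N (L + η) up).mulVec v.g
  hankel_y : window (v.ybar + v.h) (-(η : ℤ)) (L + η) = (hankel N (L + η) yp).mulVec v.g
  init : ∀ j : ℤ, -(η : ℤ) ≤ j → j < 0 → v.ubar j = u (t + j) ∧ v.ybar j = ζ (t + j)
  terminal : wnorm P (v.xibar η (L : ℤ)) ≤ ε
  input : ∀ i : ℤ, 1 ≤ i → i < L → v.ubar i ∈ U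

/-- `v` is an optimal solution of the MPC problem at time `t`. -/
def MPCOptimal {nu ny : ℕ} (N L η : ℕ) (up : Signal nu) (yp : Signal ny)
    (U : Set (Fin nu → ℝ)) (R : Matrix (Fin nu) (Fin nu) ℝ) (Q : Matrix (Fin ny) (Fin ny) ℝ)
    (P : Matrix (ExtIdx nu ny η) (ExtIdx nu ny η) ℝ) (ε lamg lamh nbar : ℝ)
    (u : Signal nu) (ζ : Signal ny) (t : ℤ) (v : MPCVar nu ny (N + 1 - (L + η))) : Prop :=
  MPCFeasible N L η up yp U P ε u ζ t v ∧
    ∀ w, MPCFeasible N L η up yp U P ε u ζ t w →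
      mpcCost η L R Q P lamg lamh nbar v ≤ mpcCost η L R Q P lamg lamh nbar w

/-! ### The self-triggering conditions and the closed loop -/

/-- Relation between the MPC terminal ingredients `(P, ε)` and the larger terminal region
`Ξ_r = {ξ : ‖ξ‖_{P_r} ≤ r}` with gain `K_r`. -/
def RadiusCondition {nu ny η : ℕ} (L : ℕ) (R : Matrix (Fin nu) (Fin nu) ℝ)
    (P Pr : Matrix (ExtIdx nu ny η) (ExtIdx nu ny η) ℝ)
    (Kr : Matrix (Fin nu) (ExtIdx nu ny η) ℝ) (ε r : ℝ) : Prop :=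
  lamMax P / lamMin Pr * (1 - lamMin (Kr.transpose * R * Kr) / lamMax Pr) ^ L * r ^ 2 ≤ ε ^ 2 ∧
    ε ^ 2 ≤ r ^ 2

/-- First triggering inequality for the inter-triggering time `τ`. -/
noncomputable def TriggerFeas {nu ny m η : ℕ}
    (Pr : Matrix (ExtIdx nu ny η) (ExtIdx nu ny η) ℝ) (r : ℝ) (ρ : ℕ → ℝ) (nbar : ℝ)
    (v : MPCVar nu ny m) (τ : ℕ) : Prop :=
  (Real.sqrt η * nbar + l2norm (window v.h (-(η : ℤ)) η))
        * Real.sqrt (∑ i ∈ Finset.Ico τ (τ + η), ρ i ^ 2)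
      + l2norm (window v.h ((τ : ℤ) - η) η)
    ≤ r / Real.sqrt (lamMax Pr) - l2norm (v.xibar η (τ : ℤ))

/-- Second triggering inequality for the inter-triggering time `τ`; `H` is the norm of the
pseudo-inverse of `H_{uξ}`. -/
noncomputable def TriggerDecr {nu ny m η : ℕ} (R : Matrix (Fin nu) (Fin nu) ℝ)
    (Q : Matrix (Fin ny) (Fin ny) ℝ)
    (Pr : Matrix (ExtIdx nu ny η) (ExtIdx nu ny η) ℝ) (H ε lamg lamh σ : ℝ) (ρ : ℕ → ℝ)
    (nbar : ℝ) (v : MPCVar nu ny m) (τ : ℕ) : Prop :=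
  2 * (lamMax Q + 2 * lamMax Pr + lamg * nbar * H ^ 2 * (1 + lamMax Pr / lamMin R))
        * ((η * nbar ^ 2 + l2norm (window v.h (-(η : ℤ)) η) ^ 2)
              * (∑ i ∈ Finset.range τ, ρ (i + η) ^ 2)
            + ∑ i ∈ Finset.range τ, l2norm (v.h (i : ℤ)) ^ 2)
      + lamh * η * nbar ^ 2 + ε ^ 2
      + 2 * (lamMax Pr + lamg * nbar * H ^ 2 * (1 + lamMax Pr / lamMin R))
        * l2norm (v.xibar η (τ : ℤ)) ^ 2
    ≤ σ * ∑ i ∈ Finset.range τ, l2norm (v.xibar η (i : ℤ)) ^ 2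

/-- The triggering times `t_0 = 0`, `t_{ℓ+1} = t_ℓ + τ_ℓ`. -/
def trigTime (τ : ℕ → ℕ) (ℓ : ℕ) : ℤ := ((∑ k ∈ Finset.range ℓ, τ k : ℕ) : ℤ)

/-- A run of the self-triggered closed loop up to the `M`-th triggering time: the plant runs from
time `-η` on (so that the first `η` measurements exist at `t_0 = 0`), the measurement noise `n` is
bounded by `nbar`, the MPC problem is solved at `t_0, …, t_{M-1}` from the past inputs and the
noisy outputs `y + n`, its optimal input is applied until the next triggering time, and each
inter-triggering time `τ_ℓ ∈ {1, …, L-1}` satisfies both triggering inequalities. -/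
structure IsClosedLoopRun {nx nu ny : ℕ} (A : Matrix (Fin nx) (Fin nx) ℝ)
    (B : Matrix (Fin nx) (Fin nu) ℝ) (C : Matrix (Fin ny) (Fin nx) ℝ)
    (D : Matrix (Fin ny) (Fin nu) ℝ) (N L η : ℕ) (up : Signal nu) (yp : Signal ny)
    (U : Set (Fin nu → ℝ)) (R : Matrix (Fin nu) (Fin nu) ℝ) (Q : Matrix (Fin ny) (Fin ny) ℝ)
    (P Pr : Matrix (ExtIdx nu ny η) (ExtIdx nu ny η) ℝ) (ε r lamg lamh σ : ℝ) (ρ : ℕ → ℝ)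
    (nbar : ℝ) (M : ℕ) (x : Signal nx) (u : Signal nu) (y n : Signal ny) (τ : ℕ → ℕ)
    (v : ℕ → MPCVar nu ny (N + 1 - (L + η))) : Prop where
  plant : IsTrajOn A B C D x u y (Set.Ici (-(η : ℤ)))
  noise : ∀ s : ℤ, -(η : ℤ) ≤ s → l2norm (n s) ≤ nbar
  optimal : ∀ ℓ < M,
    MPCOptimal N L η up yp U R Q P ε lamg lamh nbar u (y + n) (trigTime τ ℓ) (v ℓ)
  input : ∀ ℓ < M, ∀ i < τ ℓ, u (trigTime τ ℓ + (i : ℕ)) = (v ℓ).ubar ((i : ℕ) : ℤ)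
  tau_pos : ∀ ℓ < M, 1 ≤ τ ℓ
  tau_lt : ∀ ℓ < M, τ ℓ < L
  trigger_feas : ∀ ℓ < M, TriggerFeas Pr r ρ nbar (v ℓ) (τ ℓ)
  trigger_decr : ∀ ℓ < M,
    TriggerDecr R Q Pr (specNorm (pinv (hankelExt N L η up yp))) ε lamg lamh σ ρ nbar
      (v ℓ) (τ ℓ)

/-!
A prediction `ȳ + h` is a superposition of data windows, hence an exact trajectory of the system
that shares its input with the closed loop. The two outputs therefore differ by a free response
whose initial state is reconstructed from noise and slack over the last `η` samples
(`l2norm_prediction_error_le`). With the first triggering inequality this puts the true extended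
state into `Ξ_r` at every triggering time after the first. From `Ξ_r` the terminal feedback `K_r`
followed for `L` steps is feasible for the next MPC problem: it ends in `Ξ_ε` by the condition on
the radii, and Willems' fundamental lemma (`exists_hankel_mulVec`) provides the coefficient vector.
So the next optimal cost is at most `λ_max(P_r) ‖ξ‖² + ε²` plus a term of order `n̄`
(`mpcCost_le_of_terminal`), and the second triggering inequality bounds this by a multiple of `σ`
times the sum `S` of the predicted `‖ξ̄ᵢ‖²` over the interval.

The optimal cost `J` alone need not contract, because `S` involves samples before the triggering
time. The extended state is a shift register, and `W = ∑ (i+1) ‖(u, y)_{t-η+i}‖²` is a storage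
function for it: `W` grows by `η ‖(u_t, y_t)‖²` and drops by `‖ξ_t‖²` in each step
(`storage_succ`). Along a prediction the growth is paid for by the stage cost, so that
`2 J + κ W` contracts for small `σ`, with a rate that depends on `η` only
(`lyapunov_step_arith`). The threshold for `σ` involves `η`, `λ_max(Q)` and the coercivity
constants of `R` and `Q`, but neither `P_r` nor the data.

The first optimal cost has no bound in terms of `‖ξ_{t_0}‖`, since the input constraint set is only
assumed convex. For initial states in `Ξ_ε` the feedback `K` gives such a bound; otherwise
`‖ξ_{t_0}‖` is bounded below, and the decrease is started at `t_1`, where the state lies in `Ξ_r`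
(`practical_bound_of_contraction`).
-/

/-! ### Euclidean norms and quadratic forms -/

theorem l2norm_nonneg {ι : Type*} [Fintype ι] (x : ι → ℝ) : 0 ≤ l2norm x := norm_nonneg _

theorem l2norm_sq {ι : Type*} [Fintype ι] (x : ι → ℝ) : l2norm x ^ 2 = ∑ i, x i ^ 2 := by
  simp [l2norm, EuclideanSpace.norm_sq_eq]

theorem l2norm_add_le {ι : Type*} [Fintype ι] (x y : ι → ℝ) :
    l2norm (x + y) ≤ l2norm x + l2norm y := by
  simpa [l2norm] using norm_add_le (WithLp.toLp 2 x) (WithLp.toLp 2 y)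

theorem l2norm_zero {ι : Type*} [Fintype ι] : l2norm (0 : ι → ℝ) = 0 := by
  simp [l2norm]

theorem l2norm_neg {ι : Type*} [Fintype ι] (x : ι → ℝ) : l2norm (-x) = l2norm x := by
  simp [l2norm]

theorem l2norm_sub_comm {ι : Type*} [Fintype ι] (x y : ι → ℝ) :
    l2norm (x - y) = l2norm (y - x) := by
  rw [← l2norm_neg, neg_sub]

theorem l2norm_eq_zero {ι : Type*} [Fintype ι] {x : ι → ℝ} : l2norm x = 0 ↔ x = 0 := by
  simp [l2norm]

open scoped Matrix.Norms.L2Operator in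
theorem l2norm_mulVec_le {m n : Type*} [Fintype m] [DecidableEq m] [Fintype n] [DecidableEq n]
    (M : Matrix m n ℝ) (x : n → ℝ) : l2norm (M.mulVec x) ≤ specNorm M * l2norm x := by
  simpa [l2norm, specNorm] using Matrix.l2_opNorm_mulVec M (WithLp.toLp 2 x)

open scoped Matrix.Norms.L2Operator in
theorem specNorm_nonneg {m n : Type*} [Fintype m] [DecidableEq m] [Fintype n] [DecidableEq n]
    (M : Matrix m n ℝ) : 0 ≤ specNorm M := norm_nonneg M

/-- Young's inequality for the squared Euclidean norm. -/
theorem l2norm_add_sq_le {ι : Type*} [Fintype ι] (x y : ι → ℝ) {δ : ℝ} (hδ : 0 < δ) :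
    l2norm (x + y) ^ 2 ≤ (1 + δ) * l2norm x ^ 2 + (1 + 1 / δ) * l2norm y ^ 2 := by
  have h := l2norm_add_le x y
  have h0 := l2norm_nonneg (x + y)
  have h1 : l2norm (x + y) ^ 2 ≤ (l2norm x + l2norm y) ^ 2 := by gcongr
  have h2 : 0 ≤ (δ * l2norm x - l2norm y) ^ 2 / δ := by positivity
  have h3 : (δ * l2norm x - l2norm y) ^ 2 / δ
      = δ * l2norm x ^ 2 - 2 * l2norm x * l2norm y + 1 / δ * l2norm y ^ 2 := by
    field_simp
    ring
  nlinarith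

theorem dotProduct_self_eq_l2norm_sq {ι : Type*} [Fintype ι] (x : ι → ℝ) :
    x ⬝ᵥ x = l2norm x ^ 2 := by
  rw [l2norm_sq, dotProduct]
  exact Finset.sum_congr rfl fun i _ => (sq (x i)).symm

theorem wsq_nonneg {ι : Type*} [Fintype ι] {M : Matrix ι ι ℝ} (hM : M.PosSemidef) (x : ι → ℝ) :
    0 ≤ wsq M x := by
  simpa [wsq] using hM.dotProduct_mulVec_nonneg x

theorem wnorm_le_iff {ι : Type*} [Fintype ι] {M : Matrix ι ι ℝ} {x : ι → ℝ} {r : ℝ}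
    (hr : 0 ≤ r) : wnorm M x ≤ r ↔ wsq M x ≤ r ^ 2 := by
  rw [wnorm, Real.sqrt_le_left hr]

theorem finite_real_spectrum {ι : Type*} [Fintype ι] [DecidableEq ι] (M : Matrix ι ι ℝ) :
    (spectrum ℝ M).Finite := Matrix.finite_spectrum M

open scoped MatrixOrder Matrix.Norms.L2Operator in
theorem wsq_le_lamMax {ι : Type*} [Fintype ι] [DecidableEq ι] {M : Matrix ι ι ℝ}
    (hM : M.IsHermitian) (x : ι → ℝ) : wsq M x ≤ lamMax M * l2norm x ^ 2 := by
  have h : M ≤ algebraMap ℝ _ (lamMax M) := by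
    rw [le_algebraMap_iff_spectrum_le (ha := hM.isSelfAdjoint)]
    exact fun y hy => le_csSup (finite_real_spectrum M).bddAbove hy
  rw [Matrix.le_iff] at h
  have h1 := h.dotProduct_mulVec_nonneg x
  simp only [star_trivial, Matrix.sub_mulVec, dotProduct_sub, Algebra.algebraMap_eq_smul_one,
    Matrix.smul_mulVec, Matrix.one_mulVec, dotProduct_smul, dotProduct_self_eq_l2norm_sq,
    smul_eq_mul] at h1
  unfold wsq
  linarith

open scoped MatrixOrder Matrix.Norms.L2Operator in
theorem lamMin_le_wsq {ι : Type*} [Fintype ι] [DecidableEq ι] {M : Matrix ι ι ℝ}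
    (hM : M.IsHermitian) (x : ι → ℝ) : lamMin M * l2norm x ^ 2 ≤ wsq M x := by
  have h : algebraMap ℝ _ (lamMin M) ≤ M := by
    rw [algebraMap_le_iff_le_spectrum (ha := hM.isSelfAdjoint)]
    exact fun y hy => csInf_le (finite_real_spectrum M).bddBelow hy
  rw [Matrix.le_iff] at h
  have h1 := h.dotProduct_mulVec_nonneg x
  simp only [star_trivial, Matrix.sub_mulVec, dotProduct_sub, Algebra.algebraMap_eq_smul_one,
    Matrix.smul_mulVec, Matrix.one_mulVec, dotProduct_smul, dotProduct_self_eq_l2norm_sq,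
    smul_eq_mul] at h1
  unfold wsq
  linarith

open scoped MatrixOrder Matrix.Norms.L2Operator in
theorem lamMin_nonneg {ι : Type*} [Fintype ι] [DecidableEq ι] {M : Matrix ι ι ℝ}
    (hM : M.PosSemidef) : 0 ≤ lamMin M :=
  Real.sInf_nonneg fun _ hx => spectrum_nonneg_of_nonneg (Matrix.nonneg_iff_posSemidef.2 hM) hx

open scoped MatrixOrder Matrix.Norms.L2Operator in
theorem lamMax_nonneg {ι : Type*} [Fintype ι] [DecidableEq ι] {M : Matrix ι ι ℝ}
    (hM : M.PosSemidef) : 0 ≤ lamMax M :=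
  Real.sSup_nonneg fun _ hx => spectrum_nonneg_of_nonneg (Matrix.nonneg_iff_posSemidef.2 hM) hx

theorem lamMin_pos {ι : Type*} [Fintype ι] [DecidableEq ι] [Nonempty ι] {M : Matrix ι ι ℝ}
    (hM : M.PosDef) : 0 < lamMin M := by
  have hr := hM.isHermitian.spectrum_real_eq_range_eigenvalues
  have hne : (spectrum ℝ M).Nonempty := by
    rw [hr]; exact Set.range_nonempty _
  have hmem := hne.csInf_mem (finite_real_spectrum M)
  rw [hr] at hmem
  obtain ⟨i, hi⟩ := hmem
  have := hM.eigenvalues_pos i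
  rw [hi, ← hr] at this
  exact this

theorem lamMax_pos {ι : Type*} [Fintype ι] [DecidableEq ι] [Nonempty ι] {M : Matrix ι ι ℝ}
    (hM : M.PosDef) : 0 < lamMax M := by
  have hr := hM.isHermitian.spectrum_real_eq_range_eigenvalues
  obtain ⟨i⟩ := ‹Nonempty ι›
  refine (hM.eigenvalues_pos i).trans_le (le_csSup (finite_real_spectrum M).bddAbove ?_)
  rw [hr]
  exact ⟨i, rfl⟩

/-- A positive definite form is coercive; on an empty index type any constant will do. -/
theorem exists_coercive {ι : Type*} [Fintype ι] [DecidableEq ι] {M : Matrix ι ι ℝ}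
    (hM : M.PosDef) : ∃ m : ℝ, 0 < m ∧ ∀ x, m * l2norm x ^ 2 ≤ wsq M x := by
  cases isEmpty_or_nonempty ι with
  | inl h => exact ⟨1, one_pos, fun x => by simp [l2norm_sq, wsq, dotProduct]⟩
  | inr h => exact ⟨lamMin M, lamMin_pos hM, lamMin_le_wsq hM.isHermitian⟩

/-! ### Windows of signals -/

theorem l2norm_window_sq {m : ℕ} (z : Signal m) (a : ℤ) (k : ℕ) :
    l2norm (window z a k) ^ 2 = ∑ i ∈ Finset.range k, l2norm (z (a + (i : ℕ))) ^ 2 := by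
  rw [l2norm_sq, Fintype.sum_prod_type, ← Fin.sum_univ_eq_sum_range
    (fun i => l2norm (z (a + (i : ℕ))) ^ 2)]
  simp only [l2norm_sq, window]

theorem window_eq_iff {m : ℕ} {z w : Signal m} {a b : ℤ} {k : ℕ} :
    window z a k = window w b k ↔ ∀ i : ℕ, i < k → z (a + i) = w (b + i) := by
  constructor
  · intro h i hi
    funext j
    exact congrFun h (⟨i, hi⟩, j)
  · intro h
    funext p
    exact congrFun (h p.1 p.1.2) p.2

/-- Squared Euclidean norm of the input-output pair at time `t`. -/
noncomputable def ioSq {nu ny : ℕ} (u : Signal nu) (y : Signal ny) (t : ℤ) : ℝ :=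
  l2norm (u t) ^ 2 + l2norm (y t) ^ 2

theorem ioSq_nonneg {nu ny : ℕ} (u : Signal nu) (y : Signal ny) (t : ℤ) : 0 ≤ ioSq u y t := by
  unfold ioSq; positivity

theorem l2norm_extState_sq {nu ny : ℕ} (η : ℕ) (u : Signal nu) (y : Signal ny) (t : ℤ) :
    l2norm (extState η u y t) ^ 2 = ∑ i ∈ Finset.range η, ioSq u y (t - η + (i : ℕ)) := by
  simp only [ioSq, Finset.sum_add_distrib, ← l2norm_window_sq]
  rw [l2norm_sq, Fintype.sum_sum_type, l2norm_sq, l2norm_sq]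
  rfl

theorem extState_congr {nu ny η : ℕ} {u u' : Signal nu} {y y' : Signal ny} {t t' : ℤ}
    (hu : ∀ i : ℕ, i < η → u (t - η + i) = u' (t' - η + i))
    (hy : ∀ i : ℕ, i < η → y (t - η + i) = y' (t' - η + i)) :
    extState η u y t = extState η u' y' t' := by
  unfold extState
  rw [window_eq_iff.2 hu, window_eq_iff.2 hy]

/-! ### A storage function for the extended state -/

/-- The weighted sum `∑ (i+1) z_{t-η+i}` over the last `η` samples. It increases by `η z_t` and
decreases by the unweighted sum when `t` advances, which makes it a storage function for the
shift register that is contained in the extended state. -/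
def storage (η : ℕ) (z : ℤ → ℝ) (t : ℤ) : ℝ :=
  ∑ i ∈ Finset.range η, ((i : ℝ) + 1) * z (t - η + (i : ℕ))

theorem storage_succ (η : ℕ) (z : ℤ → ℝ) (t : ℤ) :
    storage η z (t + 1) + ∑ i ∈ Finset.range η, z (t - η + (i : ℕ))
      = storage η z t + η * z t := by
  have h1 : storage η z (t + 1)
      = ∑ i ∈ Finset.range (η + 1), (i : ℝ) * z (t - η + (i : ℕ)) := by
    rw [Finset.sum_range_succ']
    simp only [storage, Nat.cast_add, Nat.cast_one, Nat.cast_zero, zero_mul, add_zero]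
    refine Finset.sum_congr rfl fun i _ => ?_
    congr 2
    ring
  rw [h1, Finset.sum_range_succ, storage]
  simp only [add_mul, one_mul, Finset.sum_add_distrib, sub_add_cancel]
  ring

/-- Summed form of `storage_succ`. -/
theorem storage_add (η : ℕ) (z : ℤ → ℝ) (t : ℤ) (k : ℕ) :
    storage η z (t + k)
        + ∑ j ∈ Finset.range k, ∑ i ∈ Finset.range η, z (t + (j : ℕ) - η + (i : ℕ))
      = storage η z t + η * ∑ j ∈ Finset.range k, z (t + (j : ℕ)) := by
  induction k with
  | zero => simp
  | succ k ih =>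
    have h := storage_succ η z (t + k)
    rw [Finset.sum_range_succ, Finset.sum_range_succ, mul_add]
    push_cast
    rw [← add_assoc t (k : ℤ) 1]
    linarith

theorem sum_le_storage {η : ℕ} {z : ℤ → ℝ} (hz : ∀ s, 0 ≤ z s) (t : ℤ) :
    ∑ i ∈ Finset.range η, z (t - η + (i : ℕ)) ≤ storage η z t := by
  refine Finset.sum_le_sum fun i _ => ?_
  have := hz (t - η + (i : ℕ))
  have hi : (0 : ℝ) ≤ i := by positivity
  nlinarith

theorem storage_le_sum {η : ℕ} {z : ℤ → ℝ} (hz : ∀ s, 0 ≤ z s) (t : ℤ) :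
    storage η z t ≤ η * ∑ i ∈ Finset.range η, z (t - η + (i : ℕ)) := by
  rw [Finset.mul_sum]
  refine Finset.sum_le_sum fun i hi => ?_
  have h := hz (t - η + (i : ℕ))
  have hi : ((i : ℝ) + 1) ≤ η := by exact_mod_cast Finset.mem_range.1 hi
  gcongr

/-- Perturbation bound for `storage`. -/
theorem storage_le_of_le {η : ℕ} {z w e : ℤ → ℝ} {a b : ℝ} {t t' : ℤ} (hb : 0 ≤ b)
    (he : ∀ i : ℕ, i < η → 0 ≤ e (t' - η + i))
    (h : ∀ i : ℕ, i < η → z (t - η + i) ≤ a * w (t' - η + i) + b * e (t' - η + i)) :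
    storage η z t ≤ a * storage η w t'
      + b * (η * ∑ i ∈ Finset.range η, e (t' - η + (i : ℕ))) := by
  rw [storage, storage, Finset.mul_sum, Finset.mul_sum, Finset.mul_sum, ← Finset.sum_add_distrib]
  refine Finset.sum_le_sum fun i hi => ?_
  have hi := Finset.mem_range.1 hi
  have h1 := h i hi
  have h2 := mul_nonneg hb (he i hi)
  have hi' : ((i : ℝ) + 1) ≤ η := by exact_mod_cast hi
  have h3 : ((i : ℝ) + 1) * z (t - η + (i : ℕ))
      ≤ ((i : ℝ) + 1) * (a * w (t' - η + i) + b * e (t' - η + i)) := by gcongr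
  have h4 : ((i : ℝ) + 1) * (b * e (t' - η + i)) ≤ η * (b * e (t' - η + i)) := by gcongr
  linarith

/-- A window that ends at time `k` and starts no earlier than the window that ends at time `0` is
covered by the latter and `0, …, k-1`. -/
theorem sum_window_le {f : ℤ → ℝ} {η k : ℕ}
    (hf : ∀ i : ℕ, i < k + η → 0 ≤ f (-(η : ℤ) + i)) :
    ∑ i ∈ Finset.range η, f ((k : ℤ) - η + (i : ℕ))
      ≤ ∑ i ∈ Finset.range η, f (-(η : ℤ) + (i : ℕ))
        + ∑ i ∈ Finset.range k, f ((i : ℕ) : ℤ) := by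
  have h1 := Finset.sum_range_add (fun i : ℕ => f (-(η : ℤ) + (i : ℕ))) η k
  have h2 := Finset.sum_range_add (fun i : ℕ => f (-(η : ℤ) + (i : ℕ))) k η
  rw [add_comm η k, h2] at h1
  have h3 : 0 ≤ ∑ i ∈ Finset.range k, f (-(η : ℤ) + (i : ℕ)) :=
    Finset.sum_nonneg fun i hi => hf i (by have := Finset.mem_range.1 hi; omega)
  have h4 : ∀ i : ℕ, -(η : ℤ) + ((k + i : ℕ) : ℤ) = (k : ℤ) - η + (i : ℕ) := by
    intro i; push_cast; ring
  have h5 : ∀ i : ℕ, -(η : ℤ) + ((η + i : ℕ) : ℤ) = (i : ℕ) := by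
    intro i; push_cast; ring
  simp only [h4, h5] at h1
  linarith

/-! ### Full rank -/

theorem vecMul_eq_zero_of_rank_eq_card {m n : Type*} [Fintype m] [Fintype n]
    {M : Matrix m n ℝ} (h : M.rank = Fintype.card m) {c : m → ℝ} (hc : Matrix.vecMul c M = 0) :
    c = 0 := by
  have hli : LinearIndependent ℝ M.row := by
    rw [linearIndependent_iff_card_eq_finrank_span, ← h, Matrix.rank_eq_finrank_span_row]
    rfl
  exact (Matrix.vecMul_injective_iff.2 hli) (by simpa using hc)

theorem mulVec_eq_zero_of_rank_eq_card {m n : Type*} [Fintype m] [Fintype n]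
    {M : Matrix m n ℝ} (h : M.rank = Fintype.card n) {c : n → ℝ} (hc : M.mulVec c = 0) :
    c = 0 := by
  refine vecMul_eq_zero_of_rank_eq_card (M := M.transpose) (by rwa [Matrix.rank_transpose]) ?_
  rwa [Matrix.vecMul_transpose]

theorem exists_mulVec_eq_of_vecMul_injective {m n : Type*} [Fintype m] [DecidableEq m] [Fintype n]
    {M : Matrix m n ℝ} (h : ∀ c, Matrix.vecMul c M = 0 → c = 0) (b : m → ℝ) :
    ∃ g, M.mulVec g = b := by
  have hinj : Function.Injective (M * M.transpose).mulVec := by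
    rw [← Matrix.coe_mulVecLin, ← LinearMap.ker_eq_bot, LinearMap.ker_eq_bot']
    intro c hc
    refine h c ?_
    rw [Matrix.mulVecLin_apply, ← Matrix.mulVec_mulVec, Matrix.mulVec_transpose] at hc
    have h0 : Matrix.vecMul c M ⬝ᵥ Matrix.vecMul c M = 0 := by
      rw [← Matrix.dotProduct_mulVec, hc, dotProduct_zero]
    exact dotProduct_self_eq_zero.1 h0
  have hu := Matrix.mulVec_injective_iff_isUnit.1 hinj
  obtain ⟨c, hc⟩ := Matrix.mulVec_surjective_iff_isUnit.2 hu b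
  exact ⟨M.transpose.mulVec c, by rw [Matrix.mulVec_mulVec, hc]⟩

theorem leftPinv_mulVec_mulVec {m n : Type*} [Fintype m] [Fintype n] [DecidableEq n]
    {M : Matrix m n ℝ} (h : M.rank = Fintype.card n) (x : n → ℝ) :
    (leftPinv M).mulVec (M.mulVec x) = x := by
  have hinj : Function.Injective (M.transpose * M).mulVec := by
    rw [← Matrix.coe_mulVecLin, ← LinearMap.ker_eq_bot, LinearMap.ker_eq_bot']
    intro c hc
    exact mulVec_eq_zero_of_rank_eq_card (by rw [Matrix.rank_transpose_mul_self, h]) hc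
  have hu := (Matrix.isUnit_iff_isUnit_det _).1 (Matrix.mulVec_injective_iff_isUnit.1 hinj)
  rw [leftPinv, Matrix.mulVec_mulVec, Matrix.mul_assoc, Matrix.nonsing_inv_mul _ hu,
    Matrix.one_mulVec]

/-! ### Trajectories -/

section Trajectories

variable {nx nu ny : ℕ} {A : Matrix (Fin nx) (Fin nx) ℝ} {B : Matrix (Fin nx) (Fin nu) ℝ}
  {C : Matrix (Fin ny) (Fin nx) ℝ} {D : Matrix (Fin ny) (Fin nu) ℝ}

theorem IsTrajOn.mono {x : Signal nx} {u : Signal nu} {y : Signal ny} {S T : Set ℤ}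
    (h : IsTrajOn A B C D x u y T) (hST : S ⊆ T) : IsTrajOn A B C D x u y S :=
  fun t ht => h t (hST ht)

/-- Two trajectories with the same input differ by a free response. -/
theorem IsTrajOn.sub_eq {x x' : Signal nx} {u u' : Signal nu} {y y' : Signal ny} {a b : ℤ} {T : ℕ}
    (h : IsTrajOn A B C D x u y (Set.Ico a (a + T)))
    (h' : IsTrajOn A B C D x' u' y' (Set.Ico b (b + T)))
    (hu : ∀ k : ℕ, k < T → u (a + k) = u' (b + k)) (k : ℕ) (hk : k < T) :
    y (a + k) - y' (b + k) = (C * A ^ k).mulVec (x a - x' b) := by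
  have hx : ∀ k : ℕ, k ≤ T → x (a + k) - x' (b + k) = (A ^ k).mulVec (x a - x' b) := by
    intro k
    induction k with
    | zero => intro _; simp
    | succ k ih =>
      intro hk
      have h1 := (h (a + k) ⟨by omega, by omega⟩).1
      have h2 := (h' (b + k) ⟨by omega, by omega⟩).1
      push_cast
      rw [← add_assoc, ← add_assoc, h1, h2, hu k (by omega), add_sub_add_right_eq_sub,
        ← Matrix.mulVec_sub, ih (by omega), Matrix.mulVec_mulVec, pow_succ']
  have h1 := (h (a + k) ⟨by omega, by omega⟩).2
  have h2 := (h' (b + k) ⟨by omega, by omega⟩).2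
  rw [h1, h2, hu k hk, add_sub_add_right_eq_sub, ← Matrix.mulVec_sub, hx k hk.le,
    Matrix.mulVec_mulVec]

/-- Superposition of shifted copies of a signal; on a window this is a Hankel matrix applied to
the coefficient vector. -/
def superpose {m n : ℕ} (z : Signal m) (g : Fin n → ℝ) : Signal m :=
  fun i => ∑ j : Fin n, g j • z (i + (j : ℕ))

theorem window_superpose {m : ℕ} (N T : ℕ) (z : Signal m) (g : Fin (N + 1 - T) → ℝ) :
    window (superpose z g) 0 T = (hankel N T z).mulVec g := by
  funext p
  simp [window, superpose, hankel, Matrix.mulVec, dotProduct, mul_comm]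

theorem IsTrajOn.superpose {x : Signal nx} {u : Signal nu} {y : Signal ny} {N T : ℕ}
    (h : IsTrajOn A B C D x u y (Set.Ico 0 (N : ℤ))) (g : Fin (N + 1 - T) → ℝ) :
    IsTrajOn A B C D (superpose x g) (superpose u g) (superpose y g)
      (Set.Ico 0 (0 + (T : ℤ))) := by
  intro t ht
  obtain ⟨ht0, htT⟩ := ht
  have key : ∀ j : Fin (N + 1 - T), t + (j : ℕ) ∈ Set.Ico (0 : ℤ) N := fun j =>
    ⟨by omega, by have := j.2; omega⟩
  simp only [_root_.superpose, Matrix.mulVec_sum, Matrix.mulVec_smul, ← Finset.sum_add_distrib,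
    ← smul_add]
  constructor
  · refine Finset.sum_congr rfl fun j _ => ?_
    rw [← (h _ (key j)).1]
    congr 2
    ring
  · exact Finset.sum_congr rfl fun j _ => by rw [← (h _ (key j)).2]

/-! ### Willems' fundamental lemma -/

/-- A linear relation `∑ vᵢ·u_{j+i} + w·x_j = 0` satisfied by the data, rewritten `k` steps
ahead in terms of `x_j`, has these coefficients at the inputs. -/
def relCoeff (A : Matrix (Fin nx) (Fin nx) ℝ) (B : Matrix (Fin nx) (Fin nu) ℝ)
    (v : ℕ → Fin nu → ℝ) (w : Fin nx → ℝ) (k m : ℕ) : Fin nu → ℝ :=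
  if m < k then Matrix.vecMul w (A ^ (k - 1 - m) * B) else v (m - k)

theorem relation_shift {x : Signal nx} {u : Signal nu} {y : Signal ny} {N T : ℕ}
    (h : IsTrajOn A B C D x u y (Set.Ico 0 (N : ℤ)))
    {v : ℕ → Fin nu → ℝ} {w : Fin nx → ℝ}
    (hrel : ∀ j : ℕ, j + T ≤ N →
      ∑ i ∈ Finset.range T, v i ⬝ᵥ u ((j : ℤ) + (i : ℕ)) + w ⬝ᵥ x (j : ℤ) = 0) (k : ℕ) :
    ∀ j : ℕ, j + T + k ≤ N →
      ∑ m ∈ Finset.range (T + k), relCoeff A B v w k m ⬝ᵥ u ((j : ℤ) + (m : ℕ))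
        + Matrix.vecMul w (A ^ k) ⬝ᵥ x (j : ℤ) = 0 := by
  induction k with
  | zero => intro j hj; simpa only [relCoeff, Nat.not_lt_zero, if_false, Nat.sub_zero, add_zero, pow_zero,
      Matrix.vecMul_one] using hrel j hj
  | succ k ih =>
    intro j hj
    have h1 := ih (j + 1) (by omega)
    have h2 := (h j ⟨by omega, by omega⟩).1
    have h3 : ∀ m, relCoeff A B v w (k + 1) (m + 1) = relCoeff A B v w k m := by
      intro m
      simp only [relCoeff, Nat.add_lt_add_iff_right, Nat.add_sub_add_right]
      congr 4
      omega
    have h4 : relCoeff A B v w (k + 1) 0 = Matrix.vecMul w (A ^ k * B) := by simp [relCoeff]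
    rw [← add_assoc, Finset.sum_range_succ']
    simp only [h3, h4]
    push_cast at h1 ⊢
    rw [h2, dotProduct_add, ← add_assoc] at h1
    have h5 : Matrix.vecMul w (A ^ k) ⬝ᵥ A.mulVec (x j)
        = Matrix.vecMul w (A ^ (k + 1)) ⬝ᵥ x j := by
      rw [Matrix.dotProduct_mulVec, Matrix.vecMul_vecMul, pow_succ]
    have h6 : Matrix.vecMul w (A ^ k) ⬝ᵥ B.mulVec (u j)
        = Matrix.vecMul w (A ^ k * B) ⬝ᵥ u j := by
      rw [Matrix.dotProduct_mulVec, Matrix.vecMul_vecMul]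
    rw [h5, h6] at h1
    simp only [add_zero]
    have h7 : ∀ m : ℕ, (j : ℤ) + 1 + m = j + (m + 1) := fun m => by ring
    simp only [h7] at h1
    linarith

/-- If the input is persistently exciting of order `T + n_x` and the system is controllable, then
inputs of length `T` and initial states in the data satisfy no nontrivial linear relation. By the
Cayley–Hamilton theorem, `n_x + 1` shifted copies of a relation combine to one between the inputs
alone, and the latter must be trivial. -/
theorem relation_eq_zero {x : Signal nx} {u : Signal nu} {y : Signal ny} {N T : ℕ}
    (hctrl : IsControllable A B)
    (h : IsTrajOn A B C D x u y (Set.Ico 0 (N : ℤ)))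
    (hpe : IsPersistentlyExciting N (T + nx) u)
    {v : ℕ → Fin nu → ℝ} {w : Fin nx → ℝ} (hv : ∀ i, T ≤ i → v i = 0)
    (hrel : ∀ j : ℕ, j + T ≤ N →
      ∑ i ∈ Finset.range T, v i ⬝ᵥ u ((j : ℤ) + (i : ℕ)) + w ⬝ᵥ x (j : ℤ) = 0) :
    v = 0 ∧ w = 0 := by
  set a : ℕ → ℝ := fun k => A.charpoly.coeff k with ha
  have hdeg : A.charpoly.natDegree = nx := by
    simp
  have ha1 : a nx = 1 := by
    have := A.charpoly_monic.coeff_natDegree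
    rwa [hdeg] at this
  have hCH : ∑ k ∈ Finset.range (nx + 1), a k • A ^ k = 0 := by
    have := A.aeval_self_charpoly
    rwa [Polynomial.aeval_eq_sum_range, hdeg] at this
  set d : ℕ → Fin nu → ℝ :=
    fun m => ∑ k ∈ Finset.range (nx + 1), a k • relCoeff A B v w k m with hd
  have hd0 : ∀ m < T + nx, d m = 0 := by
    set dv : Fin (T + nx) × Fin nu → ℝ := fun p => d p.1 p.2 with hdv
    have hker : Matrix.vecMul dv (hankel N (T + nx) u) = 0 := by
      funext j
      have hj := j.2
      have h1 : ∀ k ∈ Finset.range (nx + 1),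
          ∑ m ∈ Finset.range (T + nx), relCoeff A B v w k m ⬝ᵥ u (((j : ℕ) : ℤ) + (m : ℕ))
            + Matrix.vecMul w (A ^ k) ⬝ᵥ x ((j : ℕ) : ℤ) = 0 := by
        intro k hk
        have hk := Finset.mem_range.1 hk
        rw [← relation_shift h hrel k j (by omega)]
        congr 1
        symm
        refine Finset.sum_subset (Finset.range_mono (by omega)) fun m _ hm => ?_
        have hm : T + k ≤ m := by simpa using hm
        rw [relCoeff, if_neg (by omega), hv _ (by omega), zero_dotProduct]
      have h2 : ∑ m ∈ Finset.range (T + nx), d m ⬝ᵥ u (((j : ℕ) : ℤ) + (m : ℕ))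
          + Matrix.vecMul w (∑ k ∈ Finset.range (nx + 1), a k • A ^ k) ⬝ᵥ x ((j : ℕ) : ℤ)
          = 0 := by
        have e1 : Matrix.vecMul w (∑ k ∈ Finset.range (nx + 1), a k • A ^ k)
            = ∑ k ∈ Finset.range (nx + 1), a k • Matrix.vecMul w (A ^ k) := by
          rw [← Matrix.vecMulBilin_apply (R := ℝ) (S := ℝ), map_sum]
          simp
        rw [e1]
        simp only [hd, sum_dotProduct, smul_dotProduct]
        rw [Finset.sum_comm, ← Finset.sum_add_distrib]
        refine Finset.sum_eq_zero fun k hk => ?_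
        rw [← Finset.smul_sum, ← smul_add, h1 k hk, smul_zero]
      rw [hCH, Matrix.vecMul_zero, zero_dotProduct, add_zero,
        ← Fin.sum_univ_eq_sum_range (fun m => d m ⬝ᵥ u (((j : ℕ) : ℤ) + (m : ℕ)))] at h2
      rw [Pi.zero_apply, ← h2, Matrix.vecMul, dotProduct, Fintype.sum_prod_type]
      simp only [hankel, Matrix.of_apply, hdv, dotProduct]
      refine Finset.sum_congr rfl fun m _ => Finset.sum_congr rfl fun q _ => ?_
      rw [add_comm ((m : ℕ) : ℤ)]
    have hz := vecMul_eq_zero_of_rank_eq_card (by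
      rw [hpe]; simp [mul_comm]) hker
    intro m hm
    funext q
    exact congrFun hz (⟨m, hm⟩, q)
  have hv0 : ∀ s i, T ≤ i + s → v i = 0 := by
    intro s
    induction s with
    | zero => intro i hi; exact hv i hi
    | succ s ih =>
      intro i hi
      rcases le_or_gt T (i + s) with hc | hc
      · exact ih i hc
      have h1 := hd0 (nx + i) (by omega)
      simp only [hd] at h1
      rw [Finset.sum_range_succ, Finset.sum_eq_zero, zero_add, ha1, one_smul, relCoeff,
        if_neg (by omega), Nat.add_sub_cancel_left] at h1
      · exact h1
      · intro k hk
        have hk := Finset.mem_range.1 hk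
        rw [relCoeff, if_neg (by omega), ih _ (by omega), smul_zero]
  have hvz : v = 0 := funext fun i => hv0 T i (by omega)
  refine ⟨hvz, ?_⟩
  have hw : ∀ s < nx, Matrix.vecMul w (A ^ s * B) = 0 := by
    intro s
    induction s using Nat.strong_induction_on with
    | _ s ih =>
      intro hs
      have h1 := hd0 (nx - 1 - s) (by omega)
      simp only [hd] at h1
      rw [Finset.sum_range_succ, Finset.sum_eq_zero, zero_add, ha1, one_smul, relCoeff,
        if_pos (by omega)] at h1
      · rwa [show nx - 1 - (nx - 1 - s) = s by omega] at h1
      · intro k hk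
        have hk := Finset.mem_range.1 hk
        rw [relCoeff]
        split_ifs with hc
        · rw [ih _ (by omega) (by omega), smul_zero]
        · rw [hvz, Pi.zero_apply, smul_zero]
  refine vecMul_eq_zero_of_rank_eq_card (M := ctrbMatrix A B) (by
    rw [show (ctrbMatrix A B).rank = nx from hctrl, Fintype.card_fin]) ?_
  funext p
  exact congrFun (hw p.1 p.1.2) p.2

/-- Willems' fundamental lemma: every trajectory of length `T` is a superposition of windows of
the data. -/
theorem exists_hankel_mulVec {xp : Signal nx} {up : Signal nu} {yp : Signal ny} {N T : ℕ}
    (hctrl : IsControllable A B)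
    (hp : IsTrajOn A B C D xp up yp (Set.Ico 0 (N : ℤ)))
    (hpe : IsPersistentlyExciting N (T + nx) up)
    {x : Signal nx} {u : Signal nu} {y : Signal ny} {a : ℤ}
    (h : IsTrajOn A B C D x u y (Set.Ico a (a + T))) :
    ∃ g : Fin (N + 1 - T) → ℝ, window u a T = (hankel N T up).mulVec g ∧
      window y a T = (hankel N T yp).mulVec g := by
  rcases Nat.eq_zero_or_pos T with rfl | hT
  · exact ⟨0, funext fun p => p.1.elim0, funext fun p => p.1.elim0⟩
  set X : Matrix (Fin nx) (Fin (N + 1 - T)) ℝ := Matrix.of fun q j => xp ((j : ℕ) : ℤ) q with hX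
  have hinj : ∀ c, Matrix.vecMul c (Matrix.fromRows (hankel N T up) X) = 0 → c = 0 := by
    intro c hc
    set v : ℕ → Fin nu → ℝ := fun i q => if hi : i < T then c (Sum.inl (⟨i, hi⟩, q)) else 0
      with hv
    set w : Fin nx → ℝ := fun q => c (Sum.inr q) with hw
    have hrel : ∀ j : ℕ, j + T ≤ N →
        ∑ i ∈ Finset.range T, v i ⬝ᵥ up ((j : ℤ) + (i : ℕ)) + w ⬝ᵥ xp (j : ℤ) = 0 := by
      intro j hj
      have h1 := congrFun hc ⟨j, by omega⟩
      rw [Matrix.vecMul, dotProduct, Fintype.sum_sum_type, Fintype.sum_prod_type,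
        Pi.zero_apply] at h1
      rw [← h1, ← Fin.sum_univ_eq_sum_range (fun i => v i ⬝ᵥ up ((j : ℤ) + (i : ℕ)))]
      congr 1
      refine Finset.sum_congr rfl fun i _ => Finset.sum_congr rfl fun q _ => ?_
      simp [hv, hankel, add_comm]
    obtain ⟨h1, h2⟩ := relation_eq_zero hctrl hp hpe (v := v) (w := w)
      (fun i hi => by funext q; simp [hv, hi]) hrel
    funext p
    rcases p with ⟨i, q⟩ | q
    · have := congrFun (congrFun h1 i) q
      simpa [hv] using this
    · exact congrFun h2 q
  obtain ⟨g, hg⟩ := exists_mulVec_eq_of_vecMul_injective hinj (Sum.elim (window u a T) (x a))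
  rw [Matrix.fromRows_mulVec] at hg
  have hg1 : (hankel N T up).mulVec g = window u a T := by
    funext p; exact congrFun hg (Sum.inl p)
  have hg2 : X.mulVec g = x a := by
    funext p; exact congrFun hg (Sum.inr p)
  have hx0 : superpose xp g 0 = x a := by
    rw [← hg2]
    funext q
    simp [superpose, hX, Matrix.mulVec, dotProduct, mul_comm]
  refine ⟨g, hg1.symm, ?_⟩
  rw [← window_superpose, window_eq_iff] at hg1 ⊢
  intro k hk
  have := h.sub_eq (hp.superpose g) (fun k hk => (hg1 k hk).symm) k hk
  rwa [hx0, sub_self, Matrix.mulVec_zero, sub_eq_zero] at this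

end Trajectories

/-! ### Prediction error of the MPC solution -/

section Prediction

variable {nx nu ny : ℕ} {A : Matrix (Fin nx) (Fin nx) ℝ} {B : Matrix (Fin nx) (Fin nu) ℝ}
  {C : Matrix (Fin ny) (Fin nx) ℝ} {D : Matrix (Fin ny) (Fin nu) ℝ}
  {N L η : ℕ} {xp : Signal nx} {up : Signal nu} {yp : Signal ny}
  {U : Set (Fin nu → ℝ)} {P : Matrix (ExtIdx nu ny η) (ExtIdx nu ny η) ℝ} {ε nbar : ℝ}
  {x : Signal nx} {u : Signal nu} {y n : Signal ny} {t : ℤ} {τ : ℕ} {ρ : ℕ → ℝ}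
  {v : MPCVar nu ny (N + 1 - (L + η))}

theorem l2norm_window_le {m : ℕ} {z : Signal m} {a : ℤ} {k : ℕ} {b : ℝ} (hb : 0 ≤ b)
    (h : ∀ i : ℕ, i < k → l2norm (z (a + i)) ≤ b) : l2norm (window z a k) ≤ Real.sqrt k * b := by
  have h1 : l2norm (window z a k) ^ 2 ≤ k * b ^ 2 := by
    rw [l2norm_window_sq]
    calc ∑ i ∈ Finset.range k, l2norm (z (a + (i : ℕ))) ^ 2
        ≤ ∑ _i ∈ Finset.range k, b ^ 2 := by
          refine Finset.sum_le_sum fun i hi => ?_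
          have := h i (Finset.mem_range.1 hi)
          have := l2norm_nonneg (z (a + (i : ℕ)))
          gcongr
      _ = k * b ^ 2 := by simp
  refine (Real.le_sqrt_of_sq_le h1).trans_eq ?_
  rw [Real.sqrt_mul (by positivity), Real.sqrt_sq hb]

theorem obsvMatrix_mulVec_apply (k : ℕ) (z : Fin nx → ℝ) (p : Fin k × Fin ny) :
    (obsvMatrix A C k).mulVec z p = (C * A ^ (p.1 : ℕ)).mulVec z p.2 := rfl

/-- The shifted prediction `ȳ + h` is an exact trajectory for the applied input, so it differs
from the true output by a free response. Its initial state is reconstructed, by the left inverse of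
the observability matrix, from the deviation over the `η` samples before `t`, which consists of the
noise and the slack. -/
theorem l2norm_prediction_error_le (hrank : (obsvMatrix A C η).rank = nx)
    (hp : IsTrajOn A B C D xp up yp (Set.Ico 0 (N : ℤ)))
    (hρ : ∀ i, specNorm (C * A ^ i * leftPinv (obsvMatrix A C η)) ≤ ρ i)
    (hx : IsTrajOn A B C D x u y (Set.Ici (-(η : ℤ))))
    (hnbar : 0 ≤ nbar) (hn : ∀ s : ℤ, -(η : ℤ) ≤ s → l2norm (n s) ≤ nbar) (ht : 0 ≤ t)
    (hv : MPCFeasible N L η up yp U P ε u (y + n) t v)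
    (hu : ∀ i < τ, u (t + (i : ℕ)) = v.ubar ((i : ℕ) : ℤ)) (hτ : τ ≤ L) (k : ℕ)
    (hk : k < η + τ) :
    l2norm (y (t + (-(η : ℤ) + k)) - v.ybar (-(η : ℤ) + k) - v.h (-(η : ℤ) + k))
      ≤ ρ k * (Real.sqrt η * nbar + l2norm (window v.h (-(η : ℤ)) η)) := by
  have hU := hv.hankel_u
  have hY := hv.hankel_y
  rw [← window_superpose, window_eq_iff] at hU hY
  have h1 : IsTrajOn A B C D x u y (Set.Ico (t - η) (t - η + (η + τ : ℕ))) :=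
    hx.mono fun s hs => by have := hs.1; simp only [Set.mem_Ici]; omega
  have h2 : IsTrajOn A B C D (superpose xp v.g) (superpose up v.g) (superpose yp v.g)
      (Set.Ico 0 (0 + (η + τ : ℕ))) :=
    (hp.superpose v.g).mono fun s hs => ⟨hs.1, by have := hs.2; push_cast at this ⊢; omega⟩
  have huu : ∀ k : ℕ, k < η + τ → u (t - η + k) = superpose up v.g (0 + k) := by
    intro k hk
    rw [← hU k (by omega)]
    rcases lt_or_ge k η with hkη | hkη
    · rw [(hv.init (-(η : ℤ) + k) (by omega) (by omega)).1]
      congr 1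
      ring
    · obtain ⟨i, rfl⟩ := Nat.exists_eq_add_of_le hkη
      have := hu i (by omega)
      rw [show t - η + ((η + i : ℕ) : ℤ) = t + i by push_cast; ring, this]
      congr 1
      push_cast
      ring
  have key := h1.sub_eq h2 huu
  set Δ := x (t - η) - superpose xp v.g 0 with hΔ
  set Θ := obsvMatrix A C η with hΘ
  have hdev : ∀ k : ℕ, k < η + τ →
      y (t + (-(η : ℤ) + k)) - v.ybar (-(η : ℤ) + k) - v.h (-(η : ℤ) + k)
        = (C * A ^ k).mulVec Δ := by
    intro k hk
    rw [← key k hk, ← hY k (by omega), Pi.add_apply, sub_sub]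
    congr 2
    ring
  have hΘΔ : Θ.mulVec Δ = -(window n (t - η) η + window v.h (-(η : ℤ)) η) := by
    funext p
    have hpη := p.1.2
    rw [hΘ, obsvMatrix_mulVec_apply, ← hdev _ (by omega),
      (hv.init (-(η : ℤ) + (p.1 : ℕ)) (by omega) (by omega)).2]
    simp only [window, Pi.sub_apply, Pi.add_apply, Pi.neg_apply]
    rw [show t - η + ((p.1 : ℕ) : ℤ) = t + (-(η : ℤ) + (p.1 : ℕ)) by ring]
    ring
  have hΔΘ : Δ = (leftPinv Θ).mulVec (Θ.mulVec Δ) :=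
    (leftPinv_mulVec_mulVec (by simpa using hrank) Δ).symm
  have hΘn : l2norm (Θ.mulVec Δ) ≤ Real.sqrt η * nbar + l2norm (window v.h (-(η : ℤ)) η) := by
    rw [hΘΔ, l2norm_neg]
    refine (l2norm_add_le _ _).trans (add_le_add_left ?_ _)
    exact l2norm_window_le hnbar fun i _ => hn _ (by omega)
  rw [hdev k hk, hΔΘ, Matrix.mulVec_mulVec]
  refine (l2norm_mulVec_le _ _).trans ?_
  exact mul_le_mul (hρ k) hΘn (l2norm_nonneg _) ((specNorm_nonneg _).trans (hρ k))

/-- The bracket of the second triggering inequality: it bounds, up to the factor `4`, the squared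
output prediction error accumulated over the first `τ` steps. -/
noncomputable def errBound {nu ny m : ℕ} (η : ℕ) (ρ : ℕ → ℝ) (nbar : ℝ) (v : MPCVar nu ny m)
    (τ : ℕ) : ℝ :=
  (η * nbar ^ 2 + l2norm (window v.h (-(η : ℤ)) η) ^ 2) * (∑ i ∈ Finset.range τ, ρ (i + η) ^ 2)
    + ∑ i ∈ Finset.range τ, l2norm (v.h (i : ℤ)) ^ 2

theorem errBound_nonneg {nu ny m : ℕ} (η : ℕ) (ρ : ℕ → ℝ) (nbar : ℝ) (v : MPCVar nu ny m)
    (τ : ℕ) : 0 ≤ errBound η ρ nbar v τ := by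
  unfold errBound; positivity

/-- The prediction error of the extended state after `τ` steps, as in the first triggering
inequality. -/
theorem l2norm_extState_le
    (herr : ∀ k : ℕ, k < η + τ →
      l2norm (y (t + (-(η : ℤ) + k)) - v.ybar (-(η : ℤ) + k) - v.h (-(η : ℤ) + k))
        ≤ ρ k * (Real.sqrt η * nbar + l2norm (window v.h (-(η : ℤ)) η)))
    (hnbar : 0 ≤ nbar)
    (hinit : ∀ j : ℤ, -(η : ℤ) ≤ j → j < 0 → v.ubar j = u (t + j))
    (hu : ∀ i < τ, u (t + (i : ℕ)) = v.ubar ((i : ℕ) : ℤ)) :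
    l2norm (extState η u y (t + τ)) ≤ l2norm (v.xibar η τ)
      + ((Real.sqrt η * nbar + l2norm (window v.h (-(η : ℤ)) η))
          * Real.sqrt (∑ i ∈ Finset.Ico τ (τ + η), ρ i ^ 2)
        + l2norm (window v.h ((τ : ℤ) - η) η)) := by
  set b := Real.sqrt η * nbar + l2norm (window v.h (-(η : ℤ)) η) with hb
  have hb0 : 0 ≤ b := by have := l2norm_nonneg (window v.h (-(η : ℤ)) η); positivity
  set d : Signal ny := fun i => y (t + i) - v.ybar i - v.h i with hd
  have hsplit : extState η u y (t + τ) = v.xibar η τ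
      + extState η (0 : Signal nu) (d + v.h) τ := by
    funext p
    rcases p with ⟨i, q⟩ | ⟨i, q⟩
    · have hi := i.2
      simp only [extState, MPCVar.xibar, window, Sum.elim_inl, Pi.add_apply, Pi.zero_apply,
        add_zero]
      rw [show t + (τ : ℤ) - η + (i : ℕ) = t + ((τ : ℤ) - η + (i : ℕ)) by ring]
      rcases lt_or_ge ((τ : ℤ) - η + (i : ℕ)) 0 with hc | hc
      · rw [hinit _ (by omega) hc]
      · obtain ⟨j, hj⟩ := Int.eq_ofNat_of_zero_le hc
        rw [hj, hu j (by omega)]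
    · simp only [extState, MPCVar.xibar, window, Sum.elim_inr, Pi.add_apply, hd, Pi.sub_apply]
      rw [show t + (τ : ℤ) - η + (i : ℕ) = t + ((τ : ℤ) - η + (i : ℕ)) by ring]
      ring
  have hdn : l2norm (window d ((τ : ℤ) - η) η)
      ≤ b * Real.sqrt (∑ i ∈ Finset.Ico τ (τ + η), ρ i ^ 2) := by
    have h1 : l2norm (window d ((τ : ℤ) - η) η) ^ 2
        ≤ b ^ 2 * ∑ i ∈ Finset.Ico τ (τ + η), ρ i ^ 2 := by
      rw [l2norm_window_sq, Finset.sum_Ico_eq_sum_range, Nat.add_sub_cancel_left,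
        Finset.mul_sum]
      refine Finset.sum_le_sum fun i hi => ?_
      have hi := Finset.mem_range.1 hi
      have h2 := herr (τ + i) (by omega)
      rw [show -(η : ℤ) + ((τ + i : ℕ) : ℤ) = (τ : ℤ) - η + (i : ℕ) by push_cast; ring] at h2
      have h3 : l2norm (d ((τ : ℤ) - η + (i : ℕ))) ^ 2 ≤ (ρ (τ + i) * b) ^ 2 :=
        pow_le_pow_left₀ (l2norm_nonneg _) h2 2
      linarith [mul_pow (ρ (τ + i)) b 2]
    refine (Real.le_sqrt_of_sq_le h1).trans_eq ?_
    rw [Real.sqrt_mul (by positivity), Real.sqrt_sq hb0]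
  have hext : ∀ z : Signal ny, l2norm (extState η (0 : Signal nu) z τ)
      = l2norm (window z ((τ : ℤ) - η) η) := by
    intro z
    rw [← Real.sqrt_sq (l2norm_nonneg (extState η (0 : Signal nu) z τ)),
      ← Real.sqrt_sq (l2norm_nonneg (window z ((τ : ℤ) - η) η)), l2norm_extState_sq,
      l2norm_window_sq]
    simp [ioSq, l2norm_zero]
  have hw : window (d + v.h) ((τ : ℤ) - η) η
      = window d ((τ : ℤ) - η) η + window v.h ((τ : ℤ) - η) η := rfl
  have h4 := l2norm_add_le (window d ((τ : ℤ) - η) η) (window v.h ((τ : ℤ) - η) η)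
  rw [hsplit]
  refine (l2norm_add_le _ _).trans ?_
  rw [hext, hw]
  linarith

/-- The slack and the free response each enter the output error with a factor `2`, and so do noise
and slack in the initial state of the free response. -/
theorem sum_output_error_le
    (herr : ∀ k : ℕ, k < η + τ →
      l2norm (y (t + (-(η : ℤ) + k)) - v.ybar (-(η : ℤ) + k) - v.h (-(η : ℤ) + k))
        ≤ ρ k * (Real.sqrt η * nbar + l2norm (window v.h (-(η : ℤ)) η))) :
    ∑ i ∈ Finset.range τ, l2norm (y (t + (i : ℕ)) - v.ybar (i : ℕ)) ^ 2
      ≤ 4 * errBound η ρ nbar v τ := by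
  set b := Real.sqrt η * nbar + l2norm (window v.h (-(η : ℤ)) η) with hb
  have hb2 : b ^ 2 ≤ 2 * (η * nbar ^ 2 + l2norm (window v.h (-(η : ℤ)) η) ^ 2) := by
    have h1 : (Real.sqrt η * nbar) ^ 2 = η * nbar ^ 2 := by
      rw [mul_pow, Real.sq_sqrt (by positivity)]
    rw [← h1]
    nlinarith [sq_nonneg (Real.sqrt η * nbar - l2norm (window v.h (-(η : ℤ)) η))]
  rw [errBound, mul_add, Finset.mul_sum, Finset.mul_sum, Finset.mul_sum,
    ← Finset.sum_add_distrib]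
  refine Finset.sum_le_sum fun i hi => ?_
  have hi := Finset.mem_range.1 hi
  have h1 := herr (i + η) (by omega)
  rw [show -(η : ℤ) + ((i + η : ℕ) : ℤ) = (i : ℕ) by push_cast; ring] at h1
  have h2 := l2norm_add_sq_le (y (t + (i : ℕ)) - v.ybar (i : ℕ) - v.h (i : ℕ)) (v.h (i : ℕ))
    one_pos
  rw [sub_add_cancel] at h2
  have h3 := pow_le_pow_left₀ (l2norm_nonneg _) h1 2
  rw [mul_pow] at h3
  have h4 : ρ (i + η) ^ 2 * b ^ 2
      ≤ ρ (i + η) ^ 2 * (2 * (η * nbar ^ 2 + l2norm (window v.h (-(η : ℤ)) η) ^ 2)) := by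
    gcongr
  have h5 := sq_nonneg (l2norm (v.h (i : ℕ)))
  norm_num at h2
  nlinarith

theorem ioSq_le_of_input_eq {nu ny : ℕ} {u u' : Signal nu} {y y' : Signal ny} {s s' : ℤ}
    (hu : u s = u' s') {δ : ℝ} (hδ : 0 < δ) :
    ioSq u y s ≤ (1 + δ) * ioSq u' y' s' + (1 + 1 / δ) * l2norm (y s - y' s') ^ 2 := by
  have h := l2norm_add_sq_le (y' s') (y s - y' s') hδ
  rw [add_sub_cancel] at h
  have h1 := sq_nonneg (l2norm (u' s'))
  unfold ioSq
  rw [hu]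
  nlinarith

/-- Comparison of the true and the predicted extended state, at the start and at the end of a
triggering interval. -/
theorem extState_comparison
    (hn : ∀ s : ℤ, -(η : ℤ) ≤ s → l2norm (n s) ≤ nbar) (ht : 0 ≤ t)
    (hinit : ∀ j : ℤ, -(η : ℤ) ≤ j → j < 0 → v.ubar j = u (t + j) ∧ v.ybar j = (y + n) (t + j))
    (hu : ∀ i < τ, u (t + (i : ℕ)) = v.ubar ((i : ℕ) : ℤ)) {E : ℝ}
    (hE : ∑ i ∈ Finset.range τ, l2norm (y (t + (i : ℕ)) - v.ybar (i : ℕ)) ^ 2 ≤ E)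
    {δ : ℝ} (hδ : 0 < δ) :
    storage η (ioSq u y) (t + τ) ≤ (1 + δ) * storage η (ioSq v.ubar v.ybar) τ
        + (1 + 1 / δ) * (η * (η * nbar ^ 2 + E)) ∧
      storage η (ioSq v.ubar v.ybar) 0 ≤ (1 + δ) * storage η (ioSq u y) t
        + (1 + 1 / δ) * (η * (η * nbar ^ 2)) ∧
      l2norm (extState η u y (t + τ)) ^ 2
        ≤ 2 * l2norm (v.xibar η τ) ^ 2 + 2 * (η * nbar ^ 2 + E) := by
  set e : ℤ → ℝ := fun i => l2norm (y (t + i) - v.ybar i) ^ 2 with he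
  have he0 : ∀ i, 0 ≤ e i := fun i => sq_nonneg _
  have huu : ∀ i : ℤ, -(η : ℤ) ≤ i → i < τ → u (t + i) = v.ubar i := by
    intro i h1 h2
    rcases lt_or_ge i 0 with hc | hc
    · exact (hinit i h1 hc).1.symm
    · obtain ⟨j, rfl⟩ := Int.eq_ofNat_of_zero_le hc
      exact hu j (by omega)
  have hpast : ∑ i ∈ Finset.range η, e (-(η : ℤ) + (i : ℕ)) ≤ η * nbar ^ 2 := by
    calc ∑ i ∈ Finset.range η, e (-(η : ℤ) + (i : ℕ))
        ≤ ∑ _i ∈ Finset.range η, nbar ^ 2 := by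
          refine Finset.sum_le_sum fun i hi => ?_
          have hi := Finset.mem_range.1 hi
          simp only [he]
          rw [(hinit (-(η : ℤ) + (i : ℕ)) (by omega) (by omega)).2, Pi.add_apply,
            sub_add_cancel_left, l2norm_neg]
          exact pow_le_pow_left₀ (l2norm_nonneg _) (hn _ (by omega)) 2
      _ = η * nbar ^ 2 := by simp
  have hwin : ∑ i ∈ Finset.range η, e ((τ : ℤ) - η + (i : ℕ)) ≤ η * nbar ^ 2 + E :=
    (sum_window_le fun i _ => he0 _).trans (add_le_add hpast hE)
  have hz : ∀ δ : ℝ, 0 < δ → ∀ i : ℕ, i < η → ioSq u y (t + τ - η + i)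
      ≤ (1 + δ) * ioSq v.ubar v.ybar ((τ : ℤ) - η + i)
        + (1 + 1 / δ) * e ((τ : ℤ) - η + i) := by
    intro δ hδ i hi
    rw [show t + (τ : ℤ) - η + i = t + ((τ : ℤ) - η + i) by ring]
    exact ioSq_le_of_input_eq (huu _ (by omega) (by omega)) hδ
  refine ⟨?_, ?_, ?_⟩
  · refine (storage_le_of_le (b := 1 + 1 / δ) (by positivity) (fun i _ => he0 _)
      (hz δ hδ)).trans ?_
    gcongr
  · have hz0 : ∀ i : ℕ, i < η → ioSq v.ubar v.ybar (0 - (η : ℤ) + i)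
        ≤ (1 + δ) * (fun i => ioSq u y (t + i)) (0 - (η : ℤ) + i)
          + (1 + 1 / δ) * e (0 - (η : ℤ) + i) := by
      intro i hi
      simp only [he]
      rw [l2norm_sub_comm]
      exact ioSq_le_of_input_eq (huu (0 - (η : ℤ) + i) (by omega) (by omega)).symm hδ
    refine (storage_le_of_le (b := 1 + 1 / δ) (a := 1 + δ) (w := fun i => ioSq u y (t + i))
      (t' := 0) (e := e) (by positivity) (fun i _ => he0 _) hz0).trans ?_
    have h1 : storage η (fun i => ioSq u y (t + i)) 0 = storage η (ioSq u y) t := by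
      unfold storage
      refine Finset.sum_congr rfl fun i _ => ?_
      beta_reduce
      rw [show t + (0 - (η : ℤ) + (i : ℕ)) = t - η + (i : ℕ) by ring]
    rw [h1]
    simp only [zero_sub]
    gcongr
  · have h1 : l2norm (extState η u y (t + τ)) ^ 2
        ≤ ∑ i ∈ Finset.range η, (2 * ioSq v.ubar v.ybar ((τ : ℤ) - η + (i : ℕ))
          + 2 * e ((τ : ℤ) - η + (i : ℕ))) := by
      rw [l2norm_extState_sq]
      refine Finset.sum_le_sum fun i hi => ?_
      have := hz 1 one_pos i (Finset.mem_range.1 hi)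
      norm_num at this
      exact this
    rw [Finset.sum_add_distrib, ← Finset.mul_sum, ← Finset.mul_sum] at h1
    rw [MPCVar.xibar, l2norm_extState_sq η v.ubar]
    linarith

end Prediction

/-! ### Terminal ingredients -/

section Terminal

variable {nu ny η : ℕ}
  {At : Matrix (ExtIdx nu ny η) (ExtIdx nu ny η) ℝ} {Bt : Matrix (ExtIdx nu ny η) (Fin nu) ℝ}
  {Ct : Matrix (Fin ny) (ExtIdx nu ny η) ℝ} {Dt : Matrix (Fin ny) (Fin nu) ℝ}
  {R : Matrix (Fin nu) (Fin nu) ℝ} {Q : Matrix (Fin ny) (Fin ny) ℝ} {U : Set (Fin nu → ℝ)}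
  {P Pr : Matrix (ExtIdx nu ny η) (ExtIdx nu ny η) ℝ} {K Kr : Matrix (Fin nu) (ExtIdx nu ny η) ℝ}
  {ε r : ℝ}

/-- One step of the extended state under the feedback `u = K ξ`. -/
def fbStep (At : Matrix (ExtIdx nu ny η) (ExtIdx nu ny η) ℝ)
    (Bt : Matrix (ExtIdx nu ny η) (Fin nu) ℝ) (K : Matrix (Fin nu) (ExtIdx nu ny η) ℝ)
    (ξ : ExtIdx nu ny η → ℝ) : ExtIdx nu ny η → ℝ :=
  At.mulVec ξ + Bt.mulVec (K.mulVec ξ)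

theorem IsTerminal.iterate_mem (h : IsTerminal At Bt Ct Dt R Q U P K ε)
    {ξ : ExtIdx nu ny η → ℝ} (hξ : wnorm P ξ ≤ ε) (k : ℕ) :
    wnorm P ((fbStep At Bt K)^[k] ξ) ≤ ε := by
  induction k with
  | zero => exact hξ
  | succ k ih =>
    rw [Function.iterate_succ_apply']
    exact h.invariant _ ih

theorem IsTerminal.decrease_fbStep (h : IsTerminal At Bt Ct Dt R Q U P K ε)
    {ξ : ExtIdx nu ny η → ℝ} (hξ : wnorm P ξ ≤ ε) :
    wsq P (fbStep At Bt K ξ) + (wsq R (K.mulVec ξ)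
      + wsq Q (Ct.mulVec ξ + Dt.mulVec (K.mulVec ξ))) ≤ wsq P ξ := by
  have := h.decrease ξ hξ
  rw [Matrix.add_mulVec, Matrix.add_mulVec, ← Matrix.mulVec_mulVec, ← Matrix.mulVec_mulVec] at this
  unfold fbStep
  linarith

/-- The cost accumulated under the terminal feedback. -/
theorem IsTerminal.sum_cost_le (h : IsTerminal At Bt Ct Dt R Q U P K ε)
    {ξ : ExtIdx nu ny η → ℝ} (hξ : wnorm P ξ ≤ ε) (L : ℕ) :
    ∑ k ∈ Finset.range L, (wsq R (K.mulVec ((fbStep At Bt K)^[k] ξ))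
        + wsq Q (Ct.mulVec ((fbStep At Bt K)^[k] ξ)
          + Dt.mulVec (K.mulVec ((fbStep At Bt K)^[k] ξ))))
      ≤ wsq P ξ - wsq P ((fbStep At Bt K)^[L] ξ) := by
  induction L with
  | zero => simp
  | succ L ih =>
    have := h.decrease_fbStep (h.iterate_mem hξ L)
    rw [Finset.sum_range_succ, Function.iterate_succ_apply']
    linarith

/-- Starting in the large region `Ξ_r`, its feedback leads to the small region `Ξ_ε` within `L`
steps. -/
theorem IsTerminal.wsq_iterate_le [Nonempty (ExtIdx nu ny η)]
    (h : IsTerminal At Bt Ct Dt R Q U Pr Kr r) (hP : P.PosDef) (hR : R.PosDef) (hQ : Q.PosDef)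
    {L : ℕ} (hrad : RadiusCondition L R P Pr Kr ε r)
    {ξ : ExtIdx nu ny η → ℝ} (hr : 0 ≤ r) (hξ : wnorm Pr ξ ≤ r) :
    wsq P ((fbStep At Bt Kr)^[L] ξ) ≤ ε ^ 2 := by
  have hPr := lamMin_pos h.posDef
  have hPrM := lamMax_pos h.posDef
  have hKRK : (Kr.transpose * R * Kr).PosSemidef := by
    have := hR.posSemidef.conjTranspose_mul_mul_same Kr
    rwa [Matrix.conjTranspose_eq_transpose_of_trivial] at this
  set lk := lamMin (Kr.transpose * R * Kr) with hlk
  have hlk0 : 0 ≤ lk := lamMin_nonneg hKRK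
  have hKle : ∀ ζ, lk * l2norm ζ ^ 2 ≤ wsq R (Kr.mulVec ζ) := by
    intro ζ
    have := lamMin_le_wsq hKRK.isHermitian ζ
    refine this.trans_eq ?_
    unfold wsq
    rw [← Matrix.mulVec_mulVec, ← Matrix.mulVec_mulVec, Matrix.dotProduct_mulVec,
      Matrix.vecMul_transpose]
  set q := 1 - lk / lamMax Pr with hq
  have hstep : ∀ ζ, wnorm Pr ζ ≤ r → wsq Pr (fbStep At Bt Kr ζ) ≤ q * wsq Pr ζ := by
    intro ζ hζ
    have h1 := h.decrease_fbStep hζ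
    have h2 := wsq_nonneg hQ.posSemidef (Ct.mulVec ζ + Dt.mulVec (Kr.mulVec ζ))
    have h3 := hKle ζ
    have h4 : lk / lamMax Pr * wsq Pr ζ ≤ lk * l2norm ζ ^ 2 := by
      rw [div_mul_eq_mul_div, div_le_iff₀ hPrM]
      nlinarith [wsq_le_lamMax h.posDef.isHermitian ζ]
    rw [hq, sub_mul, one_mul]
    linarith
  have hξ2 := (wnorm_le_iff hr).1 hξ
  have hPr0 : ∀ ζ, 0 ≤ wsq Pr ζ := wsq_nonneg h.posDef.posSemidef
  rcases eq_or_ne ξ 0 with rfl | hne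
  · have h0 : (fbStep At Bt Kr)^[L] 0 = 0 :=
      Function.iterate_fixed (by simp [fbStep]) L
    rw [h0]
    simpa [wsq] using sq_nonneg ε
  -- the decrease at the nonzero point `ξ` forces `λ_min(K_rᵀ R K_r) ≤ λ_max(P_r)`
  have hq0 : 0 ≤ q := by
    have hn : 0 < l2norm ξ ^ 2 :=
      pow_pos (lt_of_le_of_ne (l2norm_nonneg ξ) fun h0 => hne (l2norm_eq_zero.1 h0.symm)) 2
    have h1 : lk * l2norm ξ ^ 2 ≤ lamMax Pr * l2norm ξ ^ 2 := by
      have h1 := h.decrease_fbStep hξ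
      have h2 := wsq_nonneg hQ.posSemidef (Ct.mulVec ξ + Dt.mulVec (Kr.mulVec ξ))
      linarith [hKle ξ, wsq_le_lamMax h.posDef.isHermitian ξ, hPr0 (fbStep At Bt Kr ξ)]
    rw [hq, sub_nonneg, div_le_one hPrM]
    exact le_of_mul_le_mul_right h1 hn
  have hpow : wsq Pr ((fbStep At Bt Kr)^[L] ξ) ≤ q ^ L * r ^ 2 := by
    have hind : ∀ k, wsq Pr ((fbStep At Bt Kr)^[k] ξ) ≤ q ^ k * wsq Pr ξ := by
      intro k
      induction k with
      | zero => simp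
      | succ k ih =>
        rw [Function.iterate_succ_apply', pow_succ', mul_assoc]
        exact (hstep _ (h.iterate_mem hξ k)).trans (mul_le_mul_of_nonneg_left ih hq0)
    exact (hind L).trans (mul_le_mul_of_nonneg_left hξ2 (pow_nonneg hq0 L))
  have hN : wsq P ((fbStep At Bt Kr)^[L] ξ)
      ≤ lamMax P / lamMin Pr * (q ^ L * r ^ 2) := by
    have h1 := wsq_le_lamMax hP.isHermitian ((fbStep At Bt Kr)^[L] ξ)
    have h2 := lamMin_le_wsq h.posDef.isHermitian ((fbStep At Bt Kr)^[L] ξ)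
    have h3 := lamMax_nonneg hP.posSemidef
    rw [div_mul_eq_mul_div, le_div_iff₀ hPr]
    calc _ ≤ lamMax P * l2norm ((fbStep At Bt Kr)^[L] ξ) ^ 2 * lamMin Pr := by gcongr
      _ = lamMax P * (lamMin Pr * l2norm ((fbStep At Bt Kr)^[L] ξ) ^ 2) := by ring
      _ ≤ lamMax P * (q ^ L * r ^ 2) := by exact mul_le_mul_of_nonneg_left (h2.trans hpow) h3
  refine hN.trans ?_
  rw [← mul_assoc]
  exact hrad.1

end Terminal

/-! ### The candidate solution -/

section Candidate

variable {nx nu ny : ℕ} {A : Matrix (Fin nx) (Fin nx) ℝ} {B : Matrix (Fin nx) (Fin nu) ℝ}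
  {C : Matrix (Fin ny) (Fin nx) ℝ} {D : Matrix (Fin ny) (Fin nu) ℝ}

theorem sum_range_add_split (f : ℕ → ℝ) (L η : ℕ) :
    ∑ i ∈ Finset.range (L + η), f i
      = ∑ i ∈ Finset.range η, f i + ∑ i ∈ Finset.range L, f (η + i) := by
  rw [add_comm L η, Finset.sum_range_add]

/-- A trajectory can be continued from time `s` on with any input. -/
theorem IsTrajOn.exists_continuation {x : Signal nx} {u : Signal nu} {y : Signal ny} {a s : ℤ}
    (hx : IsTrajOn A B C D x u y (Set.Ici a)) (w : ℕ → Fin nu → ℝ) :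
    ∃ (x' : Signal nx) (u' : Signal nu) (y' : Signal ny),
      IsTrajOn A B C D x' u' y' (Set.Ici a) ∧ (∀ t < s, u' t = u t) ∧ (∀ t < s, y' t = y t) ∧
        ∀ k : ℕ, u' (s + k) = w k := by
  let X : ℕ → Fin nx → ℝ := fun k => Nat.rec (x s) (fun k z => A.mulVec z + B.mulVec (w k)) k
  let x' : Signal nx := fun t => if t < s then x t else X (t - s).toNat
  let u' : Signal nu := fun t => if t < s then u t else w (t - s).toNat
  let y' : Signal ny := fun t => if t < s then y t else C.mulVec (x' t) + D.mulVec (u' t)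
  refine ⟨x', u', y', ?_, fun t ht => if_pos ht, fun t ht => if_pos ht, fun k => ?_⟩
  · intro t ht
    rcases lt_or_ge t s with hts | hts
    · have h1 := hx t ht
      have hx' : x' t = x t := if_pos hts
      have hu' : u' t = u t := if_pos hts
      have hy' : y' t = y t := if_pos hts
      rw [hx', hu', hy']
      refine ⟨?_, h1.2⟩
      rw [← h1.1]
      rcases lt_or_ge (t + 1) s with hc | hc
      · exact if_pos hc
      · have hs : t + 1 = s := by omega
        simp only [x', hs, lt_irrefl, if_false, sub_self, Int.toNat_zero, X]
        rfl
    · refine ⟨?_, if_neg (not_lt.2 hts)⟩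
      have hx' : x' t = X (t - s).toNat := if_neg (not_lt.2 hts)
      have hu' : u' t = w (t - s).toNat := if_neg (not_lt.2 hts)
      have hx1 : x' (t + 1) = X (t + 1 - s).toNat := if_neg (by omega)
      rw [hx1, hx', hu', show (t + 1 - s).toNat = (t - s).toNat + 1 by omega]
  · have : u' (s + k) = w (s + k - s).toNat := if_neg (by omega)
    rw [this]
    congr 1
    omega

/-- If the extended state at time `s` lies in the terminal region of `(P', K')`, and the feedback
`K'` leads to the terminal region of the MPC problem within `L` steps, then this feedback together
with the slack `-n` for the past outputs is feasible, and the Lyapunov decrease in the terminal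
region bounds its cost. -/
theorem exists_feasible_of_terminal {N L η : ℕ}
    {At : Matrix (ExtIdx nu ny η) (ExtIdx nu ny η) ℝ} {Bt : Matrix (ExtIdx nu ny η) (Fin nu) ℝ}
    {Ct : Matrix (Fin ny) (ExtIdx nu ny η) ℝ} {Dt : Matrix (Fin ny) (Fin nu) ℝ}
    {R : Matrix (Fin nu) (Fin nu) ℝ} {Q : Matrix (Fin ny) (Fin ny) ℝ} {U : Set (Fin nu → ℝ)}
    {P P' : Matrix (ExtIdx nu ny η) (ExtIdx nu ny η) ℝ} {K' : Matrix (Fin nu) (ExtIdx nu ny η) ℝ}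
    {ε r' lamg lamh nbar m : ℝ} {xp : Signal nx} {up : Signal nu} {yp : Signal ny}
    {x : Signal nx} {u : Signal nu} {y n : Signal ny} {s : ℤ}
    (hctrl : IsControllable A B) (hreal : IsExtRealization A B C D η At Bt Ct Dt)
    (hL : η + 1 ≤ L)
    (hp : IsTrajOn A B C D xp up yp (Set.Ico 0 (N : ℤ)))
    (hpe : IsPersistentlyExciting N (L + nx + η) up)
    (hlamg : 0 < lamg) (hlamh : 0 < lamh) (hnbar : 0 < nbar) (hm : 0 < m)
    (hmR : ∀ z, m * l2norm z ^ 2 ≤ wsq R z) (hmQ : ∀ z, m * l2norm z ^ 2 ≤ wsq Q z)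
    (hT : IsTerminal At Bt Ct Dt R Q U P' K' r')
    (hx : IsTrajOn A B C D x u y (Set.Ici (-(η : ℤ))))
    (hn : ∀ s : ℤ, -(η : ℤ) ≤ s → l2norm (n s) ≤ nbar) (hs : 0 ≤ s)
    (hξ : wnorm P' (extState η u y s) ≤ r')
    (hend : wnorm P ((fbStep At Bt K')^[L] (extState η u y s)) ≤ ε) :
    ∃ w, MPCFeasible N L η up yp U P ε u (y + n) s w ∧
      mpcCost η L R Q P lamg lamh nbar w ≤ wsq P' (extState η u y s)
        - wsq P' ((fbStep At Bt K')^[L] (extState η u y s))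
        + wsq P ((fbStep At Bt K')^[L] (extState η u y s)) + lamh * η * nbar
        + lamg * nbar * (specNorm (pinv (Matrix.fromRows (hankel N (L + η) up)
            (hankel N (L + η) yp))) ^ 2
          * (l2norm (extState η u y s) ^ 2 + wsq P' (extState η u y s) / m)) := by
  set ξ := extState η u y s with hξdef
  set F := fbStep At Bt K' with hF
  obtain ⟨x', u', y', htraj, hu', hy', hw⟩ :=
    hx.exists_continuation (s := s) (fun k => K'.mulVec (F^[k] ξ))
  have htail : ∀ k : ℕ, extState η u' y' (s + k) = F^[k] ξ ∧
      y' (s + k) = Ct.mulVec (F^[k] ξ) + Dt.mulVec (K'.mulVec (F^[k] ξ)) := by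
    have hstate : ∀ k : ℕ, extState η u' y' (s + k) = F^[k] ξ := by
      intro k
      induction k with
      | zero =>
        simp only [Nat.cast_zero, add_zero, Function.iterate_zero, id]
        exact extState_congr (fun i hi => hu' _ (by omega)) (fun i hi => hy' _ (by omega))
      | succ k ih =>
        have := (hreal x' u' y' (s + k)
          (htraj.mono (Set.Ici_subset_Ici.2 (by omega)))).1
        rw [ih, hw] at this
        rw [Function.iterate_succ_apply', Nat.cast_succ, ← add_assoc, this, hF, fbStep]
    intro k
    refine ⟨hstate k, ?_⟩
    have := (hreal x' u' y' (s + k) (htraj.mono (Set.Ici_subset_Ici.2 (by omega)))).2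
    rwa [hstate k, hw] at this
  have hsum := hT.sum_cost_le hξ L
  set M := Matrix.fromRows (hankel N (L + η) up) (hankel N (L + η) yp) with hM
  set b : (Fin (L + η) × Fin nu) ⊕ (Fin (L + η) × Fin ny) → ℝ :=
    Sum.elim (window u' (s - η) (L + η)) (window y' (s - η) (L + η)) with hb
  obtain ⟨g₀, hg₀u, hg₀y⟩ := exists_hankel_mulVec (T := L + η) (a := s - η) hctrl hp
    (by rwa [show L + η + nx = L + nx + η by ring])
    (htraj.mono fun t ht => by have := ht.1; simp only [Set.mem_Ici]; omega)
  have hMg₀ : M.mulVec g₀ = b := by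
    rw [hM, Matrix.fromRows_mulVec, ← hg₀u, ← hg₀y]
  -- `g₀` has no norm bound, so it is replaced by the minimum-norm solution
  set g := (pinv M).mulVec b with hg
  have hMg : M.mulVec g = b := by
    rw [hg, ← hMg₀, Matrix.mulVec_mulVec, Matrix.mulVec_mulVec, (pinv_spec M).mxm]
  rw [hM, Matrix.fromRows_mulVec] at hMg
  have hgu : window u' (s - η) (L + η) = (hankel N (L + η) up).mulVec g := by
    funext p; exact (congrFun hMg (Sum.inl p)).symm
  have hgy : window y' (s - η) (L + η) = (hankel N (L + η) yp).mulVec g := by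
    funext p; exact (congrFun hMg (Sum.inr p)).symm
  let w : MPCVar nu ny (N + 1 - (L + η)) :=
    { ubar := fun i => u' (s + i)
      ybar := fun i => if i < 0 then (y + n) (s + i) else y' (s + i)
      h := fun i => if i < 0 then -n (s + i) else 0
      g := g }
  have hwy : ∀ i : ℕ, w.ybar i = y' (s + i) := by
    intro i
    simp only [w]
    rw [if_neg (not_lt.2 (Int.natCast_nonneg i))]
  have hwyh : ∀ i : ℤ, (w.ybar + w.h) i = y' (s + i) := by
    intro i
    rcases lt_or_ge i 0 with hi | hi
    · simp only [w, Pi.add_apply, if_pos hi]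
      rw [hy' _ (by omega), add_neg_cancel_right]
    · simp only [w, Pi.add_apply, if_neg (not_lt.2 hi), add_zero]
  have hxiL : w.xibar η L = F^[L] ξ := by
    rw [← (htail L).1]
    refine extState_congr (fun i hi => ?_) (fun i hi => ?_)
    · simp only [w]
      congr 1
      ring
    · have h1 : ((L : ℤ) - η + i) = ((L - η + i : ℕ) : ℤ) := by omega
      rw [h1, hwy]
      congr 1
      omega
  refine ⟨w, ⟨?_, ?_, ?_, ?_, ?_⟩, ?_⟩
  · rw [← hgu]
    refine window_eq_iff.2 fun i _ => ?_
    simp only [w]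
    congr 1
    ring
  · rw [← hgy]
    refine window_eq_iff.2 fun i _ => ?_
    rw [hwyh]
    congr 1
    ring
  · intro j _ hj
    exact ⟨hu' _ (by omega), if_pos hj⟩
  · rw [hxiL]; exact hend
  · intro i hi _
    obtain ⟨k, rfl⟩ := Int.eq_ofNat_of_zero_le (zero_le_one.trans hi)
    simp only [w]
    rw [hw]
    exact hT.input_mem _ (hT.iterate_mem hξ k)
  · have hstage : ∑ i ∈ Finset.range L, (wsq R (w.ubar (i : ℤ)) + wsq Q (w.ybar (i : ℤ)))
        ≤ wsq P' ξ - wsq P' (F^[L] ξ) := by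
      refine le_of_eq_of_le (Finset.sum_congr rfl fun i _ => ?_) hsum
      rw [hwy, (htail i).2]
      simp only [w]
      rw [hw]
    have hh : l2norm (window w.h (-(η : ℤ)) (L + η)) ^ 2 ≤ η * nbar ^ 2 := by
      rw [l2norm_window_sq, sum_range_add_split]
      have h1 : ∑ i ∈ Finset.range η, l2norm (w.h (-(η : ℤ) + (i : ℕ))) ^ 2 ≤ η * nbar ^ 2 := by
        calc _ ≤ ∑ _i ∈ Finset.range η, nbar ^ 2 := by
              refine Finset.sum_le_sum fun i hi => ?_
              have hi := Finset.mem_range.1 hi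
              have : w.h (-(η : ℤ) + (i : ℕ)) = -n (s + (-(η : ℤ) + (i : ℕ))) := by
                simp only [w]
                rw [if_pos (by omega)]
              rw [this, l2norm_neg]
              exact pow_le_pow_left₀ (l2norm_nonneg _) (hn _ (by omega)) 2
          _ = η * nbar ^ 2 := by simp
      have h2 : ∑ i ∈ Finset.range L, l2norm (w.h (-(η : ℤ) + ((η + i : ℕ) : ℤ))) ^ 2 = 0 := by
        refine Finset.sum_eq_zero fun i _ => ?_
        have : w.h (-(η : ℤ) + ((η + i : ℕ) : ℤ)) = 0 := by
          simp only [w]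
          rw [if_neg (by omega)]
        rw [this, l2norm_zero]
        norm_num
      rw [h2, add_zero]
      exact h1
    have hbn : l2norm b ^ 2 ≤ l2norm ξ ^ 2 + wsq P' ξ / m := by
      have h1 : l2norm b ^ 2 = ∑ i ∈ Finset.range (L + η), ioSq u' y' (s - η + (i : ℕ)) := by
        simp only [ioSq, Finset.sum_add_distrib, ← l2norm_window_sq]
        rw [l2norm_sq, Fintype.sum_sum_type, l2norm_sq, l2norm_sq]
        rfl
      rw [h1, sum_range_add_split]
      have h2 : ∑ i ∈ Finset.range η, ioSq u' y' (s - η + (i : ℕ)) = l2norm ξ ^ 2 := by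
        have := (htail 0).1
        simp only [Nat.cast_zero, add_zero, Function.iterate_zero, id] at this
        rw [← l2norm_extState_sq, this]
      rw [h2]
      gcongr
      rw [le_div_iff₀ hm, Finset.sum_mul]
      have hP'0 := wsq_nonneg hT.posDef.posSemidef (F^[L] ξ)
      refine le_trans ?_ (hsum.trans (by linarith))
      refine Finset.sum_le_sum fun i _ => ?_
      have h3 : s - (η : ℤ) + ((η + i : ℕ) : ℤ) = s + i := by push_cast; ring
      rw [h3, ioSq, hw, (htail i).2]
      linarith [hmR (K'.mulVec (F^[i] ξ)),
        hmQ (Ct.mulVec (F^[i] ξ) + Dt.mulVec (K'.mulVec (F^[i] ξ)))]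
    have hgn : l2norm g ^ 2 ≤ specNorm (pinv M) ^ 2 * (l2norm ξ ^ 2 + wsq P' ξ / m) := by
      have h1 := pow_le_pow_left₀ (l2norm_nonneg _) (l2norm_mulVec_le (pinv M) b) 2
      rw [mul_pow] at h1
      exact h1.trans (by gcongr)
    have hhc : lamh / nbar * l2norm (window w.h (-(η : ℤ)) (L + η)) ^ 2 ≤ lamh * η * nbar := by
      calc _ ≤ lamh / nbar * (η * nbar ^ 2) := by gcongr
        _ = lamh * η * nbar := by field_simp
    have hgc : lamg * nbar * l2norm w.g ^ 2
        ≤ lamg * nbar * (specNorm (pinv M) ^ 2 * (l2norm ξ ^ 2 + wsq P' ξ / m)) :=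
      mul_le_mul_of_nonneg_left hgn (by positivity)
    rw [mpcCost, hxiL]
    linarith

end Candidate

/-! ### The Lyapunov decrease over one triggering interval -/

theorem one_le_and_nonempty_extIdx {nx nu ny : ℕ} {A : Matrix (Fin nx) (Fin nx) ℝ}
    {C : Matrix (Fin ny) (Fin nx) ℝ} {η : ℕ} (hη : IsObservabilityIndex A C η) :
    1 ≤ η ∧ Nonempty (Fin ny) ∧ Nonempty (ExtIdx nu ny η) := by
  obtain ⟨h1, h2, h3⟩ := hη.1
  have hny : 0 < ny := by
    rcases Nat.eq_zero_or_pos ny with rfl | h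
    · have := (obsvMatrix A C η).rank_le_card_height
      rw [h3] at this
      simp at this
      omega
    · exact h
  exact ⟨h1, ⟨⟨0, hny⟩⟩, ⟨Sum.inr (⟨0, h1⟩, ⟨0, hny⟩)⟩⟩

theorem trigTime_succ (τ : ℕ → ℕ) (k : ℕ) : trigTime τ (k + 1) = trigTime τ k + τ k := by
  simp [trigTime, Finset.sum_range_succ]

theorem trigTime_nonneg (τ : ℕ → ℕ) (k : ℕ) : 0 ≤ trigTime τ k := by
  unfold trigTime; positivity

/-- The Lyapunov function is `2 J + κ W`, with `J` the optimal cost and `W` the storage of the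
extended state. The energy balance `hE` of the prediction turns cost into storage; the weight `2`
makes this a contraction in `J`. The new cost `J'`, the storage error and the factor `1 + δ` are
paid for by the dissipation `κ S`. -/
theorem lyapunov_step_arith {η κ δ σ lQ J J' W W' Wτ W₀ S E n2 a nn : ℝ}
    (hη : 1 ≤ η) (hδ : δ = 1 / (8 * η)) (hκ : 0 < κ) (hlQ : 0 < lQ)
    (hW' : W' ≤ (1 + δ) * Wτ + (1 + 1 / δ) * (η * (η * n2 + 4 * E)))
    (hEσ : 2 * lQ * E ≤ σ * S) (hE : κ * Wτ + κ * S ≤ κ * W₀ + J)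
    (hW₀ : W₀ ≤ (1 + δ) * W + (1 + 1 / δ) * (η * (η * n2))) (hS : W₀ ≤ η * S)
    (hσ : σ * (4 + 2 * κ * (1 + 1 / δ) * η / lQ) ≤ κ / 2) (hJ' : J' ≤ 2 * σ * S + a * nn)
    (hJ : 0 ≤ J) (hW : 0 ≤ W) (hS0 : 0 ≤ S) (hn2 : 0 ≤ n2) (hnn : n2 ≤ nn) :
    2 * J' + κ * W' ≤ (1 - 2 * δ) * (2 * J + κ * W)
      + (2 * a + 2 * κ * (1 + 1 / δ) * η ^ 2) * nn := by
  have hδ0 : 0 < δ := by rw [hδ]; positivity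
  have hδ8 : δ ≤ 1 / 8 := by
    rw [hδ]
    exact one_div_le_one_div_of_le (by norm_num) (by linarith)
  set c := 1 + 1 / δ with hc
  have hc0 : 0 < c := by positivity
  -- the storage error in terms of the dissipation
  have h1 : κ * c * η * (4 * E) ≤ σ * (2 * κ * c * η / lQ) * S := by
    have h4E : 4 * E ≤ 2 * (σ * S) / lQ := by
      rw [le_div_iff₀ hlQ]; linarith
    calc κ * c * η * (4 * E) ≤ κ * c * η * (2 * (σ * S) / lQ) := by gcongr
      _ = σ * (2 * κ * c * η / lQ) * S := by ring
  have h2 : σ * (4 + 2 * κ * c * η / lQ) * S ≤ κ / 2 * S := by gcongr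
  have h3 : κ * W' ≤ (1 + δ) * (κ * W₀ + J - κ * S) + κ * c * η ^ 2 * n2
      + κ * c * η * (4 * E) := by
    have e1 : κ * W' ≤ κ * ((1 + δ) * Wτ + c * (η * (η * n2 + 4 * E))) := by gcongr
    have e2 : (1 + δ) * (κ * Wτ) ≤ (1 + δ) * (κ * W₀ + J - κ * S) := by
      gcongr; linarith
    nlinarith
  -- the choice of `δ` makes `W₀ / (2 η) = 4 δ W₀`
  have h4 : 4 * δ * (κ * W₀) ≤ κ / 2 * S := by
    have : 4 * δ * (κ * W₀) ≤ 4 * δ * (κ * (η * S)) := by gcongr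
    refine this.trans_eq ?_
    rw [hδ]
    field_simp
    ring
  have h5 : (1 - 3 * δ) * (κ * W₀)
      ≤ (1 - 2 * δ) * (κ * W) + κ * c * η ^ 2 * n2 := by
    have e1 : (1 - 3 * δ) * (κ * W₀)
        ≤ (1 - 3 * δ) * (κ * ((1 + δ) * W + c * (η * (η * n2)))) := by
      have : 0 ≤ 1 - 3 * δ := by linarith
      gcongr
    have e2 : 0 ≤ κ * W := by positivity
    have e3 : 0 ≤ κ * c * η ^ 2 * n2 := by positivity
    nlinarith [mul_nonneg hδ0.le e3, mul_nonneg (mul_nonneg hδ0.le hδ0.le) e2]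
  have h6 : κ * c * η ^ 2 * n2 ≤ κ * c * η ^ 2 * nn := by gcongr
  have h7 : (1 + δ) * J ≤ (1 - 2 * δ) * (2 * J) := by nlinarith
  have h8 : 0 ≤ δ * (κ * S) := by positivity
  nlinarith

section ClosedLoop

variable {nx nu ny : ℕ} {A : Matrix (Fin nx) (Fin nx) ℝ} {B : Matrix (Fin nx) (Fin nu) ℝ}
  {C : Matrix (Fin ny) (Fin nx) ℝ} {D : Matrix (Fin ny) (Fin nu) ℝ} {N L η : ℕ}
  {At : Matrix (ExtIdx nu ny η) (ExtIdx nu ny η) ℝ} {Bt : Matrix (ExtIdx nu ny η) (Fin nu) ℝ}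
  {Ct : Matrix (Fin ny) (ExtIdx nu ny η) ℝ} {Dt : Matrix (Fin ny) (Fin nu) ℝ}
  {R : Matrix (Fin nu) (Fin nu) ℝ} {Q : Matrix (Fin ny) (Fin ny) ℝ} {U : Set (Fin nu → ℝ)}
  {P Pr P' : Matrix (ExtIdx nu ny η) (ExtIdx nu ny η) ℝ}
  {K' : Matrix (Fin nu) (ExtIdx nu ny η) ℝ}
  {ε r r' lamg lamh σ nbar m : ℝ} {ρ : ℕ → ℝ} {xp : Signal nx} {up : Signal nu} {yp : Signal ny}
  {x : Signal nx} {u : Signal nu} {y n : Signal ny} {M : ℕ} {τ : ℕ → ℕ} {s : ℤ}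

/-- The first triggering inequality keeps the true extended state in `Ξ_r`. -/
theorem wnorm_le_of_trigger [Nonempty (ExtIdx nu ny η)] (hPr : Pr.PosDef) (hr : 0 < r)
    {ξ : ExtIdx nu ny η → ℝ} (h : l2norm ξ ≤ r / Real.sqrt (lamMax Pr)) : wnorm Pr ξ ≤ r := by
  have hl := lamMax_pos hPr
  rw [wnorm_le_iff hr.le]
  calc wsq Pr ξ ≤ lamMax Pr * l2norm ξ ^ 2 := wsq_le_lamMax hPr.isHermitian ξ
    _ ≤ lamMax Pr * (r / Real.sqrt (lamMax Pr)) ^ 2 := by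
        have := l2norm_nonneg ξ
        gcongr
    _ = r ^ 2 := by
        rw [div_pow, Real.sq_sqrt hl.le]
        field_simp

/-- Lower bound of the MPC cost by the stage costs of the first `τ` steps. -/
theorem le_mpcCost {k : ℕ} (v : MPCVar nu ny k) {T : ℕ} (hT : T ≤ L) (hR : R.PosDef)
    (hQ : Q.PosDef) (hP : P.PosDef)
    (hlamg : 0 < lamg) (hlamh : 0 < lamh) (hnbar : 0 < nbar)
    (hmR : ∀ z, m * l2norm z ^ 2 ≤ wsq R z) (hmQ : ∀ z, m * l2norm z ^ 2 ≤ wsq Q z) :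
    m * ∑ i ∈ Finset.range T, ioSq v.ubar v.ybar (i : ℤ)
      ≤ mpcCost η L R Q P lamg lamh nbar v := by
  have h1 : m * ∑ i ∈ Finset.range T, ioSq v.ubar v.ybar (i : ℤ)
      ≤ ∑ i ∈ Finset.range T, (wsq R (v.ubar (i : ℤ)) + wsq Q (v.ybar (i : ℤ))) := by
    rw [Finset.mul_sum]
    refine Finset.sum_le_sum fun i _ => ?_
    rw [ioSq]
    linarith [hmR (v.ubar i), hmQ (v.ybar i)]
  have h2 : ∑ i ∈ Finset.range T, (wsq R (v.ubar (i : ℤ)) + wsq Q (v.ybar (i : ℤ)))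
      ≤ ∑ i ∈ Finset.range L, (wsq R (v.ubar (i : ℤ)) + wsq Q (v.ybar (i : ℤ))) :=
    Finset.sum_le_sum_of_subset_of_nonneg (Finset.range_mono hT) fun i _ _ =>
      add_nonneg (wsq_nonneg hR.posSemidef _) (wsq_nonneg hQ.posSemidef _)
  have h3 := wsq_nonneg hP.posSemidef (v.xibar η (L : ℤ))
  have h4 : 0 ≤ lamh / nbar * l2norm (window v.h (-(η : ℤ)) (L + η)) ^ 2 := by positivity
  have h5 : 0 ≤ lamg * nbar * l2norm v.g ^ 2 := by positivity
  unfold mpcCost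
  linarith

/-- Energy balance of a prediction: the storage after `T` steps plus the accumulated extended
states are paid for by the initial storage and the cost. -/
theorem storage_add_sum_le {k : ℕ} (v : MPCVar nu ny k) (hη : 1 ≤ η) {T : ℕ} {J : ℝ}
    (hJ : m * ∑ i ∈ Finset.range T, ioSq v.ubar v.ybar (i : ℤ) ≤ J) :
    m / η * storage η (ioSq v.ubar v.ybar) T
        + m / η * ∑ i ∈ Finset.range T, l2norm (v.xibar η (i : ℤ)) ^ 2
      ≤ m / η * storage η (ioSq v.ubar v.ybar) 0 + J := by
  have hη0 : (0 : ℝ) < η := by exact_mod_cast hη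
  have h1 := storage_add η (ioSq v.ubar v.ybar) 0 T
  simp only [zero_add] at h1
  simp only [MPCVar.xibar, l2norm_extState_sq]
  rw [← mul_add, h1, mul_add]
  have h2 : m / η * (η * ∑ i ∈ Finset.range T, ioSq v.ubar v.ybar (i : ℤ))
      = m * ∑ i ∈ Finset.range T, ioSq v.ubar v.ybar (i : ℤ) := by
    field_simp
  linarith

/-- Consequences of the second triggering inequality in which `λ_g` and `λ_h` no longer occur. -/
theorem TriggerDecr.bounds {H : ℝ} {k T : ℕ} {v : MPCVar nu ny k} (hR : R.PosDef) (hQ : Q.PosDef)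
    (hPr : Pr.PosDef) (hlamg : 0 < lamg) (hlamh : 0 < lamh) (hnbar : 0 < nbar)
    (h : TriggerDecr R Q Pr H ε lamg lamh σ ρ nbar v T) :
    2 * lamMax Q * errBound η ρ nbar v T
        ≤ σ * ∑ i ∈ Finset.range T, l2norm (v.xibar η (i : ℤ)) ^ 2 ∧
      4 * lamMax Pr * errBound η ρ nbar v T + ε ^ 2 + 2 * lamMax Pr * l2norm (v.xibar η T) ^ 2
        ≤ σ * ∑ i ∈ Finset.range T, l2norm (v.xibar η (i : ℤ)) ^ 2 := by
  have hlQ := lamMax_nonneg hQ.posSemidef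
  have hlPr := lamMax_nonneg hPr.posSemidef
  have hlR := lamMin_nonneg hR.posSemidef
  have hE := errBound_nonneg η ρ nbar v T
  unfold TriggerDecr at h
  rw [← errBound] at h
  set μ := lamg * nbar * H ^ 2 * (1 + lamMax Pr / lamMin R) with hμ
  have hμ0 : 0 ≤ μ := by positivity
  have h1 : 0 ≤ lamh * η * nbar ^ 2 := by positivity
  have h2 : 0 ≤ μ * l2norm (v.xibar η T) ^ 2 := by positivity
  have h3 : 0 ≤ lamMax Pr * l2norm (v.xibar η T) ^ 2 := by positivity
  have h4 : 0 ≤ μ * errBound η ρ nbar v T := by positivity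
  have h5 : 0 ≤ lamMax Pr * errBound η ρ nbar v T := by positivity
  have h6 : 0 ≤ lamMax Q * errBound η ρ nbar v T := by positivity
  constructor <;> nlinarith [sq_nonneg ε]

/-- The optimal cost at a state from which the terminal feedback is feasible. The contribution of
the noise is at most linear in `n̄` because the state is confined to a terminal region. -/
theorem mpcCost_le_of_terminal [Nonempty (ExtIdx nu ny η)]
    {v : MPCVar nu ny (N + 1 - (L + η))}
    (hctrl : IsControllable A B) (hreal : IsExtRealization A B C D η At Bt Ct Dt)
    (hL : η + 1 ≤ L)
    (hp : IsTrajOn A B C D xp up yp (Set.Ico 0 (N : ℤ)))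
    (hpe : IsPersistentlyExciting N (L + nx + η) up)
    (hlamg : 0 < lamg) (hlamh : 0 < lamh) (hnbar : 0 < nbar) (hm : 0 < m)
    (hmR : ∀ z, m * l2norm z ^ 2 ≤ wsq R z) (hmQ : ∀ z, m * l2norm z ^ 2 ≤ wsq Q z)
    (hT : IsTerminal At Bt Ct Dt R Q U P' K' r') (hr' : 0 < r')
    (hx : IsTrajOn A B C D x u y (Set.Ici (-(η : ℤ))))
    (hn : ∀ s : ℤ, -(η : ℤ) ≤ s → l2norm (n s) ≤ nbar) (hs : 0 ≤ s)
    (hξ : wnorm P' (extState η u y s) ≤ r')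
    (hend : wnorm P ((fbStep At Bt K')^[L] (extState η u y s)) ≤ ε)
    (hopt : MPCOptimal N L η up yp U R Q P ε lamg lamh nbar u (y + n) s v) :
    mpcCost η L R Q P lamg lamh nbar v ≤ wsq P' (extState η u y s)
        - wsq P' ((fbStep At Bt K')^[L] (extState η u y s))
        + wsq P ((fbStep At Bt K')^[L] (extState η u y s))
        + (lamh * η + lamg * (specNorm (pinv (Matrix.fromRows (hankel N (L + η) up)
            (hankel N (L + η) yp))) ^ 2 * (r' ^ 2 / lamMin P' + r' ^ 2 / m))) * nbar := by
  obtain ⟨w, hw, hcost⟩ := exists_feasible_of_terminal hctrl hreal hL hp hpe hlamg hlamh hnbar hm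
    hmR hmQ hT hx hn hs hξ hend
  refine (hopt.2 w hw).trans (hcost.trans ?_)
  have hl := lamMin_pos hT.posDef
  have h1 : wsq P' (extState η u y s) ≤ r' ^ 2 := (wnorm_le_iff hr'.le).1 hξ
  have h2 : l2norm (extState η u y s) ^ 2 ≤ r' ^ 2 / lamMin P' := by
    rw [le_div_iff₀ hl]
    linarith [lamMin_le_wsq hT.posDef.isHermitian (extState η u y s)]
  have h3 : wsq P' (extState η u y s) / m ≤ r' ^ 2 / m := by gcongr
  have h4 : lamg * nbar * (specNorm (pinv (Matrix.fromRows (hankel N (L + η) up)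
        (hankel N (L + η) yp))) ^ 2
          * (l2norm (extState η u y s) ^ 2 + wsq P' (extState η u y s) / m))
      ≤ lamg * nbar * (specNorm (pinv (Matrix.fromRows (hankel N (L + η) up)
        (hankel N (L + η) yp))) ^ 2 * (r' ^ 2 / lamMin P' + r' ^ 2 / m)) := by
    gcongr
  linarith

/-- One triggering interval of the closed loop: the next extended state lies in `Ξ_r`, and the
Lyapunov function contracts up to the noise. -/
theorem IsClosedLoopRun.lyapunov_step [Nonempty (ExtIdx nu ny η)] [Nonempty (Fin ny)]
    {v : ℕ → MPCVar nu ny (N + 1 - (L + η))}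
    (hη : 1 ≤ η) (hrank : (obsvMatrix A C η).rank = nx)
    (hR : R.PosDef) (hQ : Q.PosDef) (hP : P.PosDef) (hPr : Pr.PosDef)
    (hp : IsTrajOn A B C D xp up yp (Set.Ico 0 (N : ℤ)))
    (hρ : ∀ i, specNorm (C * A ^ i * leftPinv (obsvMatrix A C η)) ≤ ρ i)
    (hr : 0 < r) (hlamg : 0 < lamg) (hlamh : 0 < lamh) (hnbar : 0 < nbar) (hm : 0 < m)
    (hmR : ∀ z, m * l2norm z ^ 2 ≤ wsq R z) (hmQ : ∀ z, m * l2norm z ^ 2 ≤ wsq Q z)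
    {δ : ℝ} (hδ : δ = 1 / (8 * η))
    (hσ : σ * (4 + 2 * (m / η) * (1 + 1 / δ) * η / lamMax Q) ≤ m / η / 2)
    (hrun : IsClosedLoopRun A B C D N L η up yp U R Q P Pr ε r lamg lamh σ ρ nbar M x u y n τ v)
    {k : ℕ} (hk : k < M) :
    wnorm Pr (extState η u y (trigTime τ (k + 1))) ≤ r ∧
      ∀ J' a : ℝ, 0 ≤ a →
        J' ≤ lamMax Pr * l2norm (extState η u y (trigTime τ (k + 1))) ^ 2 + ε ^ 2 + a * nbar →
        2 * J' + m / η * storage η (ioSq u y) (trigTime τ (k + 1))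
          ≤ (1 - 2 * δ) * (2 * mpcCost η L R Q P lamg lamh nbar (v k)
              + m / η * storage η (ioSq u y) (trigTime τ k))
            + (2 * (a + 2 * lamMax Pr * η) + 2 * (m / η) * (1 + 1 / δ) * η ^ 2)
              * (nbar + nbar ^ 2) := by
  have hη0 : (0 : ℝ) < η := by exact_mod_cast hη
  have hη1 : (1 : ℝ) ≤ η := by exact_mod_cast hη
  have hδ0 : 0 < δ := by rw [hδ]; positivity
  have hfeas := (hrun.optimal k hk).1
  have ht := trigTime_nonneg τ k
  have hτL := hrun.tau_lt k hk
  have herr := l2norm_prediction_error_le hrank hp hρ hrun.plant hnbar.le hrun.noise ht hfeas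
    (hrun.input k hk) hτL.le
  have hsum := sum_output_error_le herr
  obtain ⟨hW', hW₀, hξ'⟩ := extState_comparison hrun.noise ht hfeas.init (hrun.input k hk)
    hsum hδ0
  obtain ⟨hb1, hb2⟩ := (hrun.trigger_decr k hk).bounds (η := η) hR hQ hPr hlamg hlamh hnbar
  rw [trigTime_succ]
  refine ⟨wnorm_le_of_trigger hPr hr ?_, ?_⟩
  · have h1 := l2norm_extState_le herr hnbar.le
      (fun j hj hj0 => (hfeas.init j hj hj0).1) (hrun.input k hk)
    have h2 : TriggerFeas Pr r ρ nbar (v k) (τ k) := hrun.trigger_feas k hk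
    unfold TriggerFeas at h2
    linarith
  · intro J' a ha hJ'
    have hJ := le_mpcCost (η := η) (P := P) (v k) hτL.le hR hQ hP hlamg hlamh hnbar hmR hmQ
    have hbal := storage_add_sum_le (v k) hη hJ
    have hz0 : ∀ s, 0 ≤ ioSq (v k).ubar (v k).ybar s := ioSq_nonneg _ _
    have hlPr := lamMax_pos hPr
    set S := ∑ i ∈ Finset.range (τ k), l2norm ((v k).xibar η (i : ℤ)) ^ 2 with hSdef
    have hS : storage η (ioSq (v k).ubar (v k).ybar) 0 ≤ η * S := by
      refine (storage_le_sum hz0 0).trans ?_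
      rw [← l2norm_extState_sq]
      refine mul_le_mul_of_nonneg_left ?_ hη0.le
      have := Finset.single_le_sum
        (f := fun i : ℕ => l2norm ((v k).xibar η (i : ℤ)) ^ 2)
        (fun i _ => sq_nonneg _) (Finset.mem_range.2 (hrun.tau_pos k hk))
      exact this
    have hJ0 : 0 ≤ mpcCost η L R Q P lamg lamh nbar (v k) :=
      le_trans (mul_nonneg hm.le (Finset.sum_nonneg fun i _ => hz0 _)) hJ
    have hW0 : 0 ≤ storage η (ioSq u y) (trigTime τ k) :=
      le_trans (Finset.sum_nonneg fun i _ => ioSq_nonneg u y _)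
        (sum_le_storage (ioSq_nonneg u y) _)
    refine lyapunov_step_arith hη1 hδ (by positivity) (lamMax_pos hQ) hW' hb1 hbal hW₀ hS hσ
      (a := a + 2 * lamMax Pr * η) ?_ hJ0 hW0 (Finset.sum_nonneg fun i _ => sq_nonneg _)
      (sq_nonneg nbar) (by linarith)
    have h1 : lamMax Pr * l2norm (extState η u y (trigTime τ k + τ k)) ^ 2
        ≤ lamMax Pr * (2 * l2norm ((v k).xibar η (τ k)) ^ 2
          + 2 * (η * nbar ^ 2 + 4 * errBound η ρ nbar (v k) (τ k))) := by gcongr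
    have h2 : 0 ≤ lamMax Pr * l2norm ((v k).xibar η (τ k)) ^ 2 := by positivity
    have h3 : 0 ≤ a * nbar ^ 2 := by positivity
    have h4 : 0 ≤ lamMax Pr * η * nbar := by positivity
    nlinarith [sq_nonneg ε]

end ClosedLoop

/-! ### From one-step contraction to practical exponential stability -/

theorem le_geometric_of_step {V : ℕ → ℝ} {γ b : ℝ} {M k₀ : ℕ} (hγ0 : 0 ≤ γ) (hγ1 : γ < 1)
    (hb : 0 ≤ b) (h : ∀ k, k₀ ≤ k → k < M → V (k + 1) ≤ γ * V k + b) (j : ℕ) :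
    k₀ + j ≤ M → V (k₀ + j) ≤ γ ^ j * V k₀ + b / (1 - γ) := by
  have h1 : 0 < 1 - γ := by linarith
  induction j with
  | zero =>
    intro _
    simp only [add_zero, pow_zero, one_mul]
    linarith [div_nonneg hb h1.le]
  | succ j ih =>
    intro hj
    have h2 := h (k₀ + j) (by omega) (by omega)
    have h3 := mul_le_mul_of_nonneg_left (ih (by omega)) hγ0
    have h4 : b / (1 - γ) = γ * (b / (1 - γ)) + b := by field_simp; ring
    rw [← add_assoc, pow_succ']
    nlinarith

theorem isKInf_mul_add_sq {a : ℝ} (ha : 0 < a) : IsKInf fun s => a * (s + s ^ 2) where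
  cont := by fun_prop
  strictMono := by
    intro s hs t ht hst
    have hs : 0 ≤ s := hs
    have : s ^ 2 < t ^ 2 := by gcongr
    exact mul_lt_mul_of_pos_left (by linarith) ha
  zero := by simp
  unbounded := by
    refine Filter.Tendsto.const_mul_atTop ha ?_
    exact Filter.tendsto_atTop_mono (fun s => le_add_of_nonneg_right (sq_nonneg s))
      Filter.tendsto_id

/-- A Lyapunov function that contracts up to `b · e` along a run of length `M` yields a practical
exponential bound if it is bounded at the start for small initial states, and uniformly bounded one
step later. For a large initial state the bound at the start is replaced by the one at the first
step, at the cost of a larger overshoot constant. -/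
theorem practical_bound_of_contraction {V X : ℕ → ℝ} {κ γ b e a₀ a₁ C₀ C₁ p q : ℝ} {M : ℕ}
    (hκ0 : 0 < κ) (hγ0 : 0 < γ) (hγ1 : γ < 1) (hb : 0 ≤ b) (he : 0 ≤ e) (ha₀ : 0 ≤ a₀)
    (ha₁ : 0 ≤ a₁) (hC₀ : 0 ≤ C₀) (hC₁ : 0 ≤ C₁) (hp : 0 < p) (hq : 0 < q)
    (hX0 : ∀ k, 0 ≤ X k) (hXV : ∀ k, κ * X k ≤ V k)
    (hstep : ∀ k < M, V (k + 1) ≤ γ * V k + b * e)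
    (hsmall : p * X 0 ≤ q → V 0 ≤ C₀ * X 0 + a₀ * e) (hone : 0 < M → V 1 ≤ C₁ + a₁ * e)
    {ℓ : ℕ} (hℓ : ℓ ≤ M) :
    X ℓ ≤ (1 + (C₀ + C₁ * p / q / γ) / κ) * γ ^ ℓ * X 0
      + (1 + (a₀ + a₁ + b / (1 - γ)) / κ) * e := by
  have h1γ : 0 < 1 - γ := by linarith
  set c₁ := C₁ * p / q / γ with hc₁
  have hc₁0 : 0 ≤ c₁ := by positivity
  have hgeom : ∀ k₀ j, k₀ + j ≤ M → V (k₀ + j) ≤ γ ^ j * V k₀ + b * e / (1 - γ) :=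
    fun k₀ j => le_geometric_of_step hγ0.le hγ1 (by positivity) (fun k _ hk => hstep k hk) j
  suffices hmain : κ * X ℓ ≤ (κ + (C₀ + c₁)) * γ ^ ℓ * X 0
      + (a₀ + a₁ + b / (1 - γ)) * e by
    have h1 : X ℓ ≤ ((κ + (C₀ + c₁)) * γ ^ ℓ * X 0
        + (a₀ + a₁ + b / (1 - γ)) * e) / κ := by
      rw [le_div_iff₀ hκ0]; linarith
    have h2 : ((κ + (C₀ + c₁)) * γ ^ ℓ * X 0
        + (a₀ + a₁ + b / (1 - γ)) * e) / κ
        = (1 + (C₀ + c₁) / κ) * γ ^ ℓ * X 0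
          + (a₀ + a₁ + b / (1 - γ)) / κ * e := by
      field_simp
    rw [h2] at h1
    linarith
  have hpw : ∀ j, 0 ≤ γ ^ j := fun j => pow_nonneg hγ0.le j
  have hpw1 : ∀ j, γ ^ j ≤ 1 := fun j => pow_le_one₀ hγ0.le hγ1.le
  have hbn : b * e / (1 - γ) = b / (1 - γ) * e := by ring
  have hp1 : 0 ≤ a₀ * e := by positivity
  have hp2 : 0 ≤ a₁ * e := by positivity
  have hp3 : 0 ≤ b / (1 - γ) * e := by positivity
  have hp4 : 0 ≤ κ * γ ^ ℓ * X 0 := by have := hpw ℓ; have := hX0 0; positivity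
  have hp5 : 0 ≤ C₀ * γ ^ ℓ * X 0 := by have := hpw ℓ; have := hX0 0; positivity
  have hp6 : 0 ≤ c₁ * γ ^ ℓ * X 0 := by have := hpw ℓ; have := hX0 0; positivity
  rcases le_or_gt (p * X 0) q with hle | hgt
  · have h1 := hgeom 0 ℓ (by omega)
    rw [zero_add, hbn] at h1
    have h2 := mul_le_mul_of_nonneg_left (hsmall hle) (hpw ℓ)
    have h3 : γ ^ ℓ * (a₀ * e) ≤ 1 * (a₀ * e) := mul_le_mul_of_nonneg_right (hpw1 ℓ) hp1
    linarith [hXV ℓ]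
  · rcases ℓ with _ | j
    · simp only [pow_zero, mul_one] at hp4 hp5 hp6 ⊢
      linarith
    · have hC₁X : C₁ ≤ c₁ * γ * X 0 := by
        have h1 : c₁ * γ * X 0 = C₁ / q * (p * X 0) := by
          rw [hc₁]; field_simp
        rw [h1]
        calc C₁ = C₁ / q * q := by field_simp
          _ ≤ C₁ / q * (p * X 0) := by gcongr
      have h1 := hgeom 1 j (by omega)
      rw [add_comm 1 j, hbn] at h1
      have h2 := mul_le_mul_of_nonneg_left
        ((hone (by omega)).trans (add_le_add_left hC₁X _)) (hpw j)
      have h3 : γ ^ j * (a₁ * e) ≤ 1 * (a₁ * e) := mul_le_mul_of_nonneg_right (hpw1 j) hp2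
      have h4 : γ ^ j * (c₁ * γ * X 0) = c₁ * γ ^ (j + 1) * X 0 := by ring
      linarith [hXV (j + 1)]

theorem mainTheorem1 {nx nu ny : ℕ}
    (A : Matrix (Fin nx) (Fin nx) ℝ) (B : Matrix (Fin nx) (Fin nu) ℝ)
    (C : Matrix (Fin ny) (Fin nx) ℝ) (D : Matrix (Fin ny) (Fin nu) ℝ)
    (hctrl : IsControllable A B) (hobs : IsObservable A C)
    (η : ℕ) (hη : IsObservabilityIndex A C η)
    (R : Matrix (Fin nu) (Fin nu) ℝ) (Q : Matrix (Fin ny) (Fin ny) ℝ)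
    (hR : R.PosDef) (hQ : Q.PosDef) :
    ∃ σbar : ℝ, 0 < σbar ∧ σbar < 1 ∧
      ∀ (At : Matrix (ExtIdx nu ny η) (ExtIdx nu ny η) ℝ)
        (Bt : Matrix (ExtIdx nu ny η) (Fin nu) ℝ)
        (Ct : Matrix (Fin ny) (ExtIdx nu ny η) ℝ) (Dt : Matrix (Fin ny) (Fin nu) ℝ)
        (_ : IsExtRealization A B C D η At Bt Ct Dt)
        (N L : ℕ) (_ : η + 1 ≤ L)
        (xp : Signal nx) (up : Signal nu) (yp : Signal ny)
        (_ : IsTrajOn A B C D xp up yp (Set.Ico 0 (N : ℤ)))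
        (_ : IsPersistentlyExciting N (L + nx + η) up)
        (U : Set (Fin nu → ℝ)) (_ : Convex ℝ U)
        (P Pr : Matrix (ExtIdx nu ny η) (ExtIdx nu ny η) ℝ)
        (K Kr : Matrix (Fin nu) (ExtIdx nu ny η) ℝ)
        (ε r lamg lamh σ : ℝ) (_ : 0 < ε) (_ : 0 < r) (_ : 0 < lamg) (_ : 0 < lamh)
        (_ : 0 < σ) (_ : σ < σbar)
        (_ : IsTerminal At Bt Ct Dt R Q U P K ε)
        (_ : IsTerminal At Bt Ct Dt R Q U Pr Kr r)
        (_ : RadiusCondition L R P Pr Kr ε r)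
        (ρ : ℕ → ℝ) (_ : ∀ i, specNorm (C * A ^ i * leftPinv (obsvMatrix A C η)) ≤ ρ i),
      ∃ (c γ₂ : ℝ) (α : ℝ → ℝ), 0 < c ∧ 0 < γ₂ ∧ γ₂ < 1 ∧ IsKInf α ∧
        ∀ (nbar : ℝ) (_ : 0 < nbar) (M : ℕ)
          (x : Signal nx) (u : Signal nu) (y n : Signal ny) (τ : ℕ → ℕ)
          (v : ℕ → MPCVar nu ny (N + 1 - (L + η)))
          (_ : IsClosedLoopRun A B C D N L η up yp U R Q P Pr ε r lamg lamh σ ρ nbar M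
            x u y n τ v),
        ∀ ℓ ≤ M,
          l2norm (extState η u y (trigTime τ ℓ)) ^ 2 ≤
            c * γ₂ ^ ℓ * l2norm (extState η u y (trigTime τ 0)) ^ 2 + α nbar := by
  obtain ⟨hη1, hny, hne⟩ := one_le_and_nonempty_extIdx (nu := nu) hη
  have hrank := hη.1.2.2
  have hη0 : (0 : ℝ) < η := by exact_mod_cast hη1
  obtain ⟨mR, hmR0, hmR'⟩ := exists_coercive hR
  obtain ⟨mQ, hmQ0, hmQ'⟩ := exists_coercive hQ
  obtain ⟨m, hm, hmR, hmQ⟩ : ∃ m : ℝ, 0 < m ∧ (∀ z, m * l2norm z ^ 2 ≤ wsq R z) ∧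
      ∀ z, m * l2norm z ^ 2 ≤ wsq Q z :=
    ⟨min mR mQ, lt_min hmR0 hmQ0,
      fun z => le_trans (by gcongr; exact min_le_left _ _) (hmR' z),
      fun z => le_trans (by gcongr; exact min_le_right _ _) (hmQ' z)⟩
  have hlQ := lamMax_pos hQ
  set δ : ℝ := 1 / (8 * η) with hδ
  have hδ0 : 0 < δ := by positivity
  have hδ8 : δ ≤ 1 / 8 := by
    rw [hδ]
    refine one_div_le_one_div_of_le (by norm_num) ?_
    have : (1 : ℝ) ≤ η := by exact_mod_cast hη1
    linarith
  set κ : ℝ := m / η with hκ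
  have hκ0 : 0 < κ := by positivity
  -- for `σ ≤ κ / (2 s₀)` the new cost and the storage error use at most half of the dissipation
  set s₀ : ℝ := 4 + 2 * κ * (1 + 1 / δ) * η / lamMax Q with hs₀
  have hs₀0 : 0 < s₀ := by positivity
  refine ⟨min (1 / 2) (κ / 2 / s₀), lt_min (by norm_num) (by positivity),
    (min_le_left _ _).trans_lt (by norm_num), ?_⟩
  intro At Bt Ct Dt hreal N L hL xp up yp hp hpe U _ P Pr K Kr ε r lamg lamh σ hε hr hlamg hlamh
    _ hσ hT hTr hrad ρ hρ
  have hσ' : σ * s₀ ≤ κ / 2 := by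
    rw [← le_div_iff₀ hs₀0]
    exact hσ.le.trans (min_le_right _ _)
  have hlP := lamMax_pos hT.posDef
  have hlPr := lamMin_pos hTr.posDef
  have hlPrM := lamMax_pos hTr.posDef
  -- noise gains of the optimal cost on the two terminal regions
  set G := specNorm (pinv (Matrix.fromRows (hankel N (L + η) up) (hankel N (L + η) yp))) ^ 2
    with hG
  have hG0 : 0 ≤ G := sq_nonneg _
  set aP := lamh * η + lamg * (G * (ε ^ 2 / lamMin P + ε ^ 2 / m)) with haP
  set aPr := lamh * η + lamg * (G * (r ^ 2 / lamMin Pr + r ^ 2 / m)) with haPr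
  have haP0 : 0 ≤ aP := by have := lamMin_pos hT.posDef; positivity
  have haPr0 : 0 ≤ aPr := by positivity
  set γ := 1 - 2 * δ with hγ
  have hγ0 : 0 < γ := by linarith
  have hγ1 : γ < 1 := by linarith
  set bs := 2 * (aPr + 2 * lamMax Pr * η) + 2 * κ * (1 + 1 / δ) * η ^ 2 with hbs
  have hbs0 : 0 ≤ bs := by positivity
  set C₀ := 2 * lamMax P + κ * η with hC₀
  have hC₀0 : 0 ≤ C₀ := by positivity
  set C₁ := 2 * (r ^ 2 + ε ^ 2) + κ * η * (r ^ 2 / lamMin Pr) with hC₁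
  have hC₁0 : 0 ≤ C₁ := by positivity
  have h1γ : 0 < 1 - γ := by linarith
  refine ⟨1 + (C₀ + C₁ * lamMax P / ε ^ 2 / γ) / κ, γ,
    fun s => (1 + (2 * aP + 2 * aPr + bs / (1 - γ)) / κ) * (s + s ^ 2), by positivity, hγ0, hγ1,
    isKInf_mul_add_sq (by positivity), ?_⟩
  intro nbar hnbar M x u y n τ v hrun ℓ hℓ
  set nn := nbar + nbar ^ 2 with hnn
  have hnn0 : 0 ≤ nn := by positivity
  have hnn1 : nbar ≤ nn := le_add_of_nonneg_right (sq_nonneg _)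
  set X : ℕ → ℝ := fun k => l2norm (extState η u y (trigTime τ k)) ^ 2 with hX
  have hX0 : ∀ k, 0 ≤ X k := fun k => sq_nonneg _
  set W : ℕ → ℝ := fun k => storage η (ioSq u y) (trigTime τ k) with hW
  -- no MPC problem is solved at the last triggering time of a finite run
  set J : ℕ → ℝ := fun k => if k < M then mpcCost η L R Q P lamg lamh nbar (v k) else 0 with hJ
  set V : ℕ → ℝ := fun k => 2 * J k + κ * W k with hV
  have hXW : ∀ k, X k ≤ W k := by
    intro k
    simp only [hX, hW]
    rw [l2norm_extState_sq]
    exact sum_le_storage (ioSq_nonneg u y) _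
  have hWX : ∀ k, W k ≤ η * X k := by
    intro k
    simp only [hX, hW]
    rw [l2norm_extState_sq]
    exact storage_le_sum (ioSq_nonneg u y) _
  have hJ0 : ∀ k, 0 ≤ J k := by
    intro k
    simp only [hJ]
    split_ifs
    · refine le_trans ?_ (le_mpcCost (η := η) (P := P) (v k) (Nat.zero_le L) hR hQ hT.posDef hlamg
        hlamh hnbar hmR hmQ)
      simp
    · exact le_rfl
  have hXV : ∀ k, κ * X k ≤ V k := by
    intro k
    have := mul_le_mul_of_nonneg_left (hXW k) hκ0.le
    simp only [hV]
    linarith [hJ0 k]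
  have hstep := fun k (hk : k < M) => hrun.lyapunov_step hη1 hrank hR hQ hT.posDef hTr.posDef hp hρ
    hr hlamg hlamh hnbar hm hmR hmQ hδ hσ' hk
  -- the optimal cost inside the large terminal region
  have hJr : ∀ k < M, J (k + 1) ≤ wsq Pr (extState η u y (trigTime τ (k + 1))) + ε ^ 2
      + aPr * nbar := by
    intro k hk
    have hin := (hstep k hk).1
    have hw := wsq_nonneg hTr.posDef.posSemidef (extState η u y (trigTime τ (k + 1)))
    simp only [hJ]
    split_ifs with hk1
    · have hend := hTr.wsq_iterate_le hT.posDef hR hQ hrad hr.le hin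
      have h1 := mpcCost_le_of_terminal hctrl hreal hL hp hpe hlamg hlamh hnbar hm hmR hmQ hTr hr
        hrun.plant hrun.noise (trigTime_nonneg τ (k + 1)) hin ((wnorm_le_iff hε.le).2 hend)
        (hrun.optimal (k + 1) hk1)
      have h2 := wsq_nonneg hTr.posDef.posSemidef
        ((fbStep At Bt Kr)^[L] (extState η u y (trigTime τ (k + 1))))
      linarith
    · positivity
  have hVstep : ∀ k, k < M → V (k + 1) ≤ γ * V k + bs * nn := by
    intro k hk
    have h1 := (hstep k hk).2 (J (k + 1)) aPr haPr0 ((hJr k hk).trans (by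
      gcongr
      exact wsq_le_lamMax hTr.posDef.isHermitian _))
    have h2 : J k = mpcCost η L R Q P lamg lamh nbar (v k) := if_pos hk
    rw [← h2] at h1
    exact h1
  refine practical_bound_of_contraction (V := V) (X := X) hκ0 hγ0 hγ1 hbs0 hnn0 (by positivity)
    (by positivity) hC₀0 hC₁0 hlP (sq_pos_of_pos hε) hX0 hXV hVstep ?_ ?_ hℓ
  · -- the initial state lies in the terminal region of the MPC problem, which bounds `J 0`
    intro hsmall
    have hin : wnorm P (extState η u y (trigTime τ 0)) ≤ ε :=
      (wnorm_le_iff hε.le).2 ((wsq_le_lamMax hT.posDef.isHermitian _).trans hsmall)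
    have hJ₀ : J 0 ≤ lamMax P * X 0 + aP * nbar := by
      simp only [hJ]
      split_ifs with hM
      · have h1 := mpcCost_le_of_terminal hctrl hreal hL hp hpe hlamg hlamh hnbar hm hmR hmQ hT hε
          hrun.plant hrun.noise (trigTime_nonneg τ 0) hin (hT.iterate_mem hin L)
          (hrun.optimal 0 hM)
        have h2 : wsq P (extState η u y (trigTime τ 0)) ≤ lamMax P * X 0 :=
          wsq_le_lamMax hT.posDef.isHermitian _
        linarith
      · have := hX0 0
        positivity
    have h1 := mul_le_mul_of_nonneg_left (hWX 0) hκ0.le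
    have h2 : aP * nbar ≤ aP * nn := by gcongr
    simp only [hV, hC₀]
    linarith
  · -- after one interval the state has been brought into `Ξ_r`, however large it was initially
    intro hM
    have hin := (wnorm_le_iff hr.le).1 (hstep 0 hM).1
    have h3 := hJr 0 hM
    rw [zero_add] at h3 hin
    have hX₁ : X 1 ≤ r ^ 2 / lamMin Pr := by
      rw [le_div_iff₀ hlPr]
      have : lamMin Pr * X 1 ≤ wsq Pr (extState η u y (trigTime τ 1)) :=
        lamMin_le_wsq hTr.posDef.isHermitian _
      linarith
    have h1 := mul_le_mul_of_nonneg_left (hWX 1) hκ0.le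
    have h2 := mul_le_mul_of_nonneg_left hX₁ (mul_nonneg hκ0.le hη0.le)
    have h4 : aPr * nbar ≤ aPr * nn := by gcongr
    simp only [hV, hC₁]
    linarith
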